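/- **Setting.** Let $n\ge 1$, $\alpha>-1$, and let $\mathbb B^n=\{z\in\mathbb C^n: |z|^2=\sum_k|z_k|^2<1\}$. Let $dv=\frac{n!}{\pi^n}\,dz$ be Lebesgue measure on $\mathbb B^n$ normalised to total mass one, and put $dv_\alpha(z)=c_\alpha(1-|z|^2)^\alpha\,dv(z)$ with $c_\alpha=\frac{\Gamma(n+\alpha+1)}{n!\,\Gamma(\alpha+1)}$. The weighted Bergman space $\mathcal H^2_\alpha(\mathbb B^n)$ is the space of holomorphic functions in $L^2(\mathbb B^n,v_\alpha)$. For $a\in L^\infty(\mathbb B^n)$ the Toeplitz operator $T_a$ on $\mathcal H^2_\alpha(\mathbb B^n)$ is $$T_af(z)=\int_{\mathbb B^n}a(w)f(w)(1-z\cdot\overline w)^{-(n+\alpha+1)}\,dv_\alpha(w).$$ A symbol $a\in L^\infty(\mathbb B^n)$ is *alternating separately radial* ($A_n\rtimes\mathbb T^n$-invariant) if there is a measurable function of $r=(r_1,\dots,r_n)$, again denoted $a$, with $a(z)=a(|z_1|,\dots,|z_n|)$ for almost every $z\in\mathbb B^n$, and if for every even permutation $\sigma\in A_n$ one has $a(z_{\sigma(1)},\dots,z_{\sigma(n)})=a(z)$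 for almost every $z\in\mathbb B^n$. For $\iota\in\mathbb Z_+^n$ and $\sigma\in S_n$ let $\sigma(\iota)=(\iota_{\sigma(1)},\dots,\iota_{\sigma(n)})$, and let $\mathcal I_\iota=\{\sigma(\iota):\sigma\in S_n\}$, $\mathcal I_\iota^+=\{\sigma(\iota):\sigma\in A_n\}$, $\mathcal I_\iota^-=\{\sigma(\iota):\sigma\in S_n\setminus A_n\}$. Let $\mathcal I^0$ be the set of $\iota\in\mathbb Z_+^n$ with $\iota_1\ge\cdots\ge\iota_n$ and $\iota_i=\iota_j$ for some $i\ne j$, and let $\mathcal I^c$ be the set of $\iota\in\mathbb Z_+^n$ with $\iota_1>\cdots>\iota_n$. For $S\subseteq\mathbb Z_+^n$ regard $\ell^2(S)$ as the subspace of $\ell^2(\mathbb Z_+^n)$ of sequences vanishing outside $S$. Let $e_m(z)=\sqrt{\frac{\Gamma(n+|m|+\alpha+1)}{m!\,\Gamma(n+\alpha+1)}}\;z^m$ for $m\in\mathbb Z_+^n$. **Theorem.** For every alternating separately radial symbol $a$ the formula above defines a unique bounded operator $T_a$ on $\mathcal H^2_\alpha(\mathbb B^n)$. The $C^*$-algebra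 of bounded operators on $\mathcal H^2_\alpha(\mathbb B^n)$ generated by all these $T_a$ is commutative. More precisely, the map $R(f)=(\langle f,e_m\rangle)_{m\in\mathbb Z_+^n}$ is a unitary operator from $\mathcal H^2_\alpha(\mathbb B^n)$ onto $\ell^2(\mathbb Z_+^n)$, one has the orthogonal Hilbert sum $$\ell^2(\mathbb Z_+^n)=\Big(\bigoplus_{\iota\in\mathcal I^0}\ell^2(\mathcal I_\iota)\Big)\oplus\Big(\bigoplus_{\iota\in\mathcal I^c}\ell^2(\mathcal I_\iota^+)\oplus\ell^2(\mathcal I_\iota^-)\Big),$$ and, for every alternating separately radial symbol $a$ and every odd permutation $\sigma$, $$RT_aR^*=\Big(\bigoplus_{\iota\in\mathcal I^0}\gamma_a(\iota)\,I|_{\ell^2(\mathcal I_\iota)}\Big)\oplus\Big(\bigoplus_{\iota\in\mathcal I^c}\gamma_a(\iota)\,I|_{\ell^2(\mathcal I_\iota^+)}\oplus\gamma_a(\sigma(\iota))\,I|_{\ell^2(\mathcal I_\iota^-)}\Big)$$ (for $n=1$ there is no odd $\sigma$, $\mathcal I_\iota^-=\emptyset$ and the last summands are zero), where for every $m\in\mathbb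 Z_+^n$ $$\gamma_a(m)=\frac{2^n\,\Gamma(n+|m|+\alpha+1)}{m!\,\Gamma(\alpha+1)}\int_{\tau(\mathbb B^n)}a(r)\,r^{2m}(1-|r|^2)^\alpha\prod_{k=1}^n r_k\,dr_k,\qquad \tau(\mathbb B^n)=\{r\in[0,\infty)^n:|r|<1\}.$$ -/

import Mathlib

open MeasureTheory Set Filter Topology
open scoped ENNReal NNReal

noncomputable section

namespace AltToeplitz

/-- The open unit ball of `ℂⁿ` for the Euclidean norm. -/
def unitBall (n : ℕ) : Set (Fin n → ℂ) := {z | ∑ i, ‖z i‖ ^ 2 < 1}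

/-- Lebesgue measure on the unit ball, normalised to total mass one
(the Lebesgue volume of the unit ball of `ℂⁿ` is `πⁿ / n!`). -/
def ballMeasure (n : ℕ) : Measure (Fin n → ℂ) :=
  ENNReal.ofReal ((n.factorial : ℝ) / Real.pi ^ n) • volume.restrict (unitBall n)

/-- The constant `c_α = Γ(n + α + 1) / (n! Γ(α + 1))`. -/
def weightConst (n : ℕ) (α : ℝ) : ℝ :=
  Real.Gamma (n + α + 1) / (n.factorial * Real.Gamma (α + 1))

/-- The weighted measure `dv_α(z) = c_α (1 - |z|²)^α dv(z)` on the unit ball. -/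
def weightedMeasure (n : ℕ) (α : ℝ) : Measure (Fin n → ℂ) :=
  (ballMeasure n).withDensity
    fun z => ENNReal.ofReal (weightConst n α * (1 - ∑ i, ‖z i‖ ^ 2) ^ α)

/-- The weighted Bergman space: the classes in `L²(v_α)` of functions holomorphic on the ball. -/
def bergmanSpace (n : ℕ) (α : ℝ) : Submodule ℂ (Lp ℂ 2 (weightedMeasure n α)) where
  carrier := {f | ∃ g : (Fin n → ℂ) → ℂ,
    DifferentiableOn ℂ g (unitBall n) ∧ f =ᵐ[weightedMeasure n α] g}
  zero_mem' := ⟨0, differentiableOn_const 0, Lp.coeFn_zero _ _ _⟩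
  add_mem' := by
    rintro f₁ f₂ ⟨g₁, h₁, e₁⟩ ⟨g₂, h₂, e₂⟩
    exact ⟨g₁ + g₂, h₁.add h₂, (Lp.coeFn_add f₁ f₂).trans (e₁.add e₂)⟩
  smul_mem' := by
    rintro c f ⟨g, h, e⟩
    exact ⟨c • g, h.const_smul c, (Lp.coeFn_smul c f).trans (e.const_smul c)⟩

/-! ### Completeness of the Bergman space -/

theorem isOpen_unitBall (n : ℕ) : IsOpen (unitBall n) :=
  isOpen_lt (by fun_prop) continuous_const

theorem circle_bound {n : ℕ} {g : (Fin n → ℂ) → ℂ} {z w : Fin n → ℂ} {r : ℝ}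
    (hg : DifferentiableOn ℂ g (Metric.ball z r)) (hw : ‖w‖ < r) :
    ‖g z‖ₑ * ENNReal.ofReal (2 * Real.pi) ≤
      ∫⁻ θ in Ioc (0 : ℝ) (2 * Real.pi), ‖g (z + circleMap 0 1 θ • w)‖ₑ := by
  have hd : DiffContOnCl ℂ (fun ζ : ℂ => g (z + ζ • w)) (Metric.ball 0 |1|) := by
    apply DifferentiableOn.diffContOnCl
    have : Metric.ball (0 : ℂ) |1| = Metric.ball 0 1 := by simp
    rw [this, closure_ball _ one_ne_zero]
    refine hg.comp (by fun_prop) ?_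
    intro ζ hζ
    simp only [Metric.mem_closedBall, dist_zero_right] at hζ
    simp only [Metric.mem_ball, dist_self_add_left, norm_smul]
    exact (mul_le_of_le_one_left (norm_nonneg _) hζ).trans_lt hw
  have h := hd.circleAverage
  simp only [Real.circleAverage, zero_smul, add_zero] at h
  rw [intervalIntegral.integral_of_le (by positivity)] at h
  rw [← h, enorm_smul, Real.enorm_eq_ofReal (by positivity), mul_right_comm,
    ← ENNReal.ofReal_mul (by positivity), inv_mul_cancel₀ (by positivity), ENNReal.ofReal_one,
    one_mul]
  exact enorm_integral_le_lintegral_enorm _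

theorem enorm_mul_volume_le {n : ℕ} {g : (Fin n → ℂ) → ℂ} {z : Fin n → ℂ} {r : ℝ}
    (hg : DifferentiableOn ℂ g (Metric.ball z r)) :
    ‖g z‖ₑ * volume (Metric.ball z r) ≤ ∫⁻ w in Metric.ball z r, ‖g w‖ₑ := by
  set F : (Fin n → ℂ) → ℝ≥0∞ := (Metric.ball z r).indicator (fun w => ‖g w‖ₑ) with hF
  have hFm : Measurable F := by
    classical
    rw [hF, ← piecewise_eq_indicator]
    exact hg.continuousOn.enorm.measurable_piecewise continuousOn_const measurableSet_ball
  have hmp : ∀ θ : ℝ, MeasurePreserving (fun w : Fin n → ℂ => circleMap 0 1 θ • w) := by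
    intro θ
    have h1 : MeasurePreserving (fun x : ℂ => circleMap 0 1 θ * x) := by
      have := (rotation (Circle.exp θ)).measurePreserving
      convert this using 2 with x
      simp [circleMap, Circle.coe_exp]
    exact volume_preserving_pi (fun _ : Fin n => h1)
  have key : ∀ θ : ℝ, ∫⁻ w, F (z + circleMap 0 1 θ • w) = ∫⁻ w, F w := by
    intro θ
    rw [(hmp θ).lintegral_comp (f := fun w => F (z + w)) (by fun_prop)]
    exact lintegral_add_left_eq_self F z
  have hpi : ENNReal.ofReal (2 * Real.pi) ≠ 0 := by
    simp [Real.pi_pos]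
  have hvol : volume (Metric.ball (0 : Fin n → ℂ) r) = volume (Metric.ball z r) :=
    (Measure.addHaar_ball_center volume z r).symm
  rw [← lintegral_indicator measurableSet_ball, ← hvol]
  have h1 : ‖g z‖ₑ * ENNReal.ofReal (2 * Real.pi) * volume (Metric.ball (0 : Fin n → ℂ) r) ≤
      ∫⁻ w, ∫⁻ θ in Ioc (0 : ℝ) (2 * Real.pi), F (z + circleMap 0 1 θ • w) := by
    rw [← setLIntegral_const]
    refine (setLIntegral_mono' measurableSet_ball ?_).trans (setLIntegral_le_lintegral _ _)
    intro w hw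
    rw [mem_ball_zero_iff] at hw
    refine (circle_bound hg hw).trans (le_of_eq ?_)
    refine lintegral_congr fun θ => ?_
    rw [hF, indicator_of_mem]
    simpa [norm_smul] using hw
  have h2 : ∫⁻ w, ∫⁻ θ in Ioc (0 : ℝ) (2 * Real.pi), F (z + circleMap 0 1 θ • w) =
      ENNReal.ofReal (2 * Real.pi) * ∫⁻ w, F w := by
    rw [lintegral_lintegral_swap]
    · simp only [key, lintegral_const, Measure.restrict_apply MeasurableSet.univ, univ_inter,
        Real.volume_Ioc, sub_zero, mul_comm]
    · refine Measurable.aemeasurable ?_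
      refine hFm.comp ?_
      have hc : Measurable (circleMap 0 1) := (continuous_circleMap 0 1).measurable
      fun_prop
  rw [h2, mul_comm ‖g z‖ₑ, mul_assoc] at h1
  exact (ENNReal.mul_le_mul_iff_right hpi ENNReal.ofReal_ne_top).mp h1


theorem exists_le_weightedMeasure {n : ℕ} {α : ℝ} (hc : 0 < weightConst n α)
    {K : Set (Fin n → ℂ)} (hK : IsCompact K) (hKU : K ⊆ unitBall n) :
    ∃ c : ℝ≥0∞, c ≠ 0 ∧ c ≠ ⊤ ∧ c • volume.restrict K ≤ weightedMeasure n α := by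
  have hk : 0 < (n.factorial : ℝ) / Real.pi ^ n := by positivity
  have hcont : ContinuousOn
      (fun z : Fin n → ℂ => weightConst n α * (1 - ∑ i, ‖z i‖ ^ 2) ^ α) K := by
    refine continuousOn_const.mul (ContinuousOn.rpow_const (by fun_prop) ?_)
    intro z hz
    exact Or.inl (sub_pos.mpr (hKU hz)).ne'
  have hpos : ∀ z ∈ K, 0 < weightConst n α * (1 - ∑ i, ‖z i‖ ^ 2) ^ α := fun z hz =>
    mul_pos hc (Real.rpow_pos_of_pos (sub_pos.mpr (hKU hz)) _)
  obtain ⟨c, hc0, hcK⟩ : ∃ c : ℝ, 0 < c ∧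
      ∀ z ∈ K, c ≤ weightConst n α * (1 - ∑ i, ‖z i‖ ^ 2) ^ α := by
    rcases K.eq_empty_or_nonempty with rfl | hne
    · exact ⟨1, one_pos, by simp⟩
    · obtain ⟨z, hz, hmin⟩ := hK.exists_isMinOn hne hcont
      exact ⟨_, hpos z hz, fun w hw => hmin hw⟩
  refine ⟨ENNReal.ofReal ((n.factorial : ℝ) / Real.pi ^ n) * ENNReal.ofReal c, ?_,
    ENNReal.mul_ne_top ENNReal.ofReal_ne_top ENNReal.ofReal_ne_top, ?_⟩
  · exact mul_ne_zero (by simpa using hk) (by simpa using hc0)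
  · refine Measure.le_iff.mpr fun s hs => ?_
    have hsK : MeasurableSet (s ∩ K) := hs.inter hK.measurableSet
    rw [weightedMeasure, ballMeasure, withDensity_apply _ hs, Measure.restrict_smul,
      lintegral_smul_measure, Measure.smul_apply, smul_eq_mul, smul_eq_mul, mul_assoc]
    gcongr
    rw [Measure.restrict_restrict hs, Measure.restrict_apply hs]
    calc ENNReal.ofReal c * volume (s ∩ K) = ∫⁻ _ in s ∩ K, ENNReal.ofReal c := by
          rw [setLIntegral_const]
      _ ≤ ∫⁻ z in s ∩ K, ENNReal.ofReal (weightConst n α * (1 - ∑ i, ‖z i‖ ^ 2) ^ α) :=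
          setLIntegral_mono' hsK fun z hz => ENNReal.ofReal_le_ofReal (hcK z hz.2)
      _ ≤ _ := lintegral_mono_set (inter_subset_inter_right s hKU)

theorem exists_local_bound {n : ℕ} {α : ℝ} (hc : 0 < weightConst n α)
    {z₀ : Fin n → ℂ} (hz₀ : z₀ ∈ unitBall n) :
    ∃ ε > 0, Metric.ball z₀ ε ⊆ unitBall n ∧ ∃ C : ℝ≥0, ∀ g : (Fin n → ℂ) → ℂ,
      DifferentiableOn ℂ g (unitBall n) → ∀ z ∈ Metric.ball z₀ ε,
        ‖g z‖ₑ ≤ C * eLpNorm g 2 (weightedMeasure n α) := by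
  obtain ⟨δ, hδ, hδU⟩ := Metric.isOpen_iff.mp (isOpen_unitBall n) z₀ hz₀
  have hKU : Metric.closedBall z₀ (2 * (δ / 3)) ⊆ unitBall n :=
    (Metric.closedBall_subset_ball (by linarith)).trans hδU
  obtain ⟨c, hc0, hct, hcμ⟩ := exists_le_weightedMeasure hc
    (isCompact_closedBall z₀ (2 * (δ / 3))) hKU
  set V := volume (Metric.ball (0 : Fin n → ℂ) (δ / 3)) with hV
  have hV0 : V ≠ 0 := (Metric.measure_ball_pos _ _ (by positivity)).ne'
  have hVt : V ≠ ⊤ := measure_ball_lt_top.ne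
  have hs0 : c ^ (2⁻¹ : ℝ) ≠ 0 := by simp [ENNReal.rpow_eq_zero_iff, hc0, hct]
  have hst : c ^ (2⁻¹ : ℝ) ≠ ⊤ := by simp [ENNReal.rpow_eq_top_iff, hc0, hct]
  have hVst : V ^ (2⁻¹ : ℝ) ≠ ⊤ := by simp [ENNReal.rpow_eq_top_iff, hV0, hVt]
  refine ⟨δ / 3, by positivity, (Metric.ball_subset_ball (by linarith)).trans hδU,
    ((c ^ (2⁻¹ : ℝ))⁻¹ * V ^ (2⁻¹ : ℝ) * V⁻¹).toNNReal, fun g hg z hz => ?_⟩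
  rw [ENNReal.coe_toNNReal (ENNReal.mul_ne_top (ENNReal.mul_ne_top (ENNReal.inv_ne_top.mpr hs0)
    hVst) (ENNReal.inv_ne_top.mpr hV0))]
  have hB : Metric.ball z (δ / 3) ⊆ Metric.closedBall z₀ (2 * (δ / 3)) := by
    intro w hw
    rw [Metric.mem_ball] at hw hz
    rw [Metric.mem_closedBall]
    linarith [dist_triangle w z z₀]
  have hgB : DifferentiableOn ℂ g (Metric.ball z (δ / 3)) := hg.mono (hB.trans hKU)
  have h1 := enorm_mul_volume_le hgB
  have hVz : volume (Metric.ball z (δ / 3)) = V := Measure.addHaar_ball_center volume z _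
  have h2 := eLpNorm_le_eLpNorm_mul_rpow_measure_univ (p := 1) (q := 2) (by norm_num)
    (hgB.continuousOn.aestronglyMeasurable (μ := volume) measurableSet_ball)
  rw [Measure.restrict_apply_univ, hVz, eLpNorm_one_eq_lintegral_enorm] at h2
  have hexp : 1 / ENNReal.toReal 1 - 1 / ENNReal.toReal 2 = (2⁻¹ : ℝ) := by norm_num
  rw [hexp] at h2
  have h3 : c ^ (2⁻¹ : ℝ) * eLpNorm g 2 (volume.restrict (Metric.ball z (δ / 3))) ≤
      eLpNorm g 2 (weightedMeasure n α) := by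
    have := eLpNorm_smul_measure_of_ne_top (p := 2) (by norm_num) g c
      (μ := volume.restrict (Metric.ball z (δ / 3)))
    norm_num at this
    rw [← one_div, ← this]
    refine eLpNorm_mono_measure g (le_trans ?_ hcμ)
    gcongr
  rw [hVz] at h1
  have h4 : eLpNorm g 2 (volume.restrict (Metric.ball z (δ / 3))) ≤
      (c ^ (2⁻¹ : ℝ))⁻¹ * eLpNorm g 2 (weightedMeasure n α) := by
    rw [← ENNReal.div_eq_inv_mul, ENNReal.le_div_iff_mul_le (Or.inl hs0) (Or.inl hst), mul_comm]
    exact h3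
  have h5 : ‖g z‖ₑ * V ≤
      (c ^ (2⁻¹ : ℝ))⁻¹ * eLpNorm g 2 (weightedMeasure n α) * V ^ (2⁻¹ : ℝ) := by
    refine h1.trans (h2.trans ?_)
    gcongr
  have h6 : ‖g z‖ₑ ≤
      (c ^ (2⁻¹ : ℝ))⁻¹ * eLpNorm g 2 (weightedMeasure n α) * V ^ (2⁻¹ : ℝ) / V := by
    rwa [ENNReal.le_div_iff_mul_le (Or.inl hV0) (Or.inl hVt)]
  refine h6.trans (le_of_eq ?_)
  rw [div_eq_mul_inv]
  ring

theorem ae_mem_unitBall (n : ℕ) (α : ℝ) : ∀ᵐ z ∂weightedMeasure n α, z ∈ unitBall n := by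
  refine (withDensity_absolutelyContinuous _ _).ae_le ?_
  exact Measure.ae_smul_measure (ae_restrict_mem (isOpen_unitBall n).measurableSet) _

theorem isClosed_bergmanSpace (n : ℕ) (α : ℝ) :
    IsClosed (bergmanSpace n α : Set (Lp ℂ 2 (weightedMeasure n α))) := by
  rcases le_or_gt (weightConst n α) 0 with hc | hc
  · have hμ : weightedMeasure n α = 0 := by
      have hz : (ballMeasure n).withDensity (fun z =>
          ENNReal.ofReal (weightConst n α * (1 - ∑ i, ‖z i‖ ^ 2) ^ α)) =
          (ballMeasure n).withDensity 0 := by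
        refine withDensity_congr_ae (Measure.ae_smul_measure ?_ _)
        filter_upwards [ae_restrict_mem (isOpen_unitBall n).measurableSet] with z hz
        exact ENNReal.ofReal_eq_zero.mpr (mul_nonpos_of_nonpos_of_nonneg hc
          (Real.rpow_nonneg (sub_pos.mpr hz).le _))
      rw [weightedMeasure, hz, withDensity_zero]
    have : (bergmanSpace n α : Set (Lp ℂ 2 (weightedMeasure n α))) = univ := by
      refine eq_univ_of_forall fun f => ⟨0, differentiableOn_const 0, ?_⟩
      refine (ae_iff.mpr ?_ : ∀ᵐ z ∂weightedMeasure n α, _)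
      generalize {z | ¬ (f z = (0 : (Fin n → ℂ) → ℂ) z)} = s
      rw [hμ, Measure.coe_zero, Pi.zero_apply]
    rw [this]
    exact isClosed_univ
  refine IsSeqClosed.isClosed fun u f hu huf => ?_
  choose g hg hgu using hu
  have hb : ∀ z₀ ∈ unitBall n, ∃ ε > 0, Metric.ball z₀ ε ⊆ unitBall n ∧
      UniformCauchySeqOn g atTop (Metric.ball z₀ ε) := by
    intro z₀ hz₀
    obtain ⟨ε, hε, hεU, C, hC⟩ := exists_local_bound hc hz₀
    refine ⟨ε, hε, hεU, Metric.uniformCauchySeqOn_iff.mpr fun η hη => ?_⟩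
    obtain ⟨N, hN⟩ := Metric.cauchySeq_iff.mp huf.cauchySeq (η / (C + 1)) (by positivity)
    refine ⟨N, fun k hk l hl z hz => ?_⟩
    have h1 := hC (g k - g l) ((hg k).sub (hg l)) z hz
    have h2 : eLpNorm (g k - g l) 2 (weightedMeasure n α) = ‖u k - u l‖ₑ := by
      rw [Lp.enorm_def]
      exact eLpNorm_congr_ae (((hgu k).sub (hgu l)).symm.trans (Lp.coeFn_sub _ _).symm)
    rw [h2, ← ofReal_norm, ← ofReal_norm, ← ENNReal.ofReal_coe_nnreal,
      ← ENNReal.ofReal_mul (by positivity),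
      ENNReal.ofReal_le_ofReal_iff (by positivity)] at h1
    have h3 := hN k hk l hl
    rw [dist_eq_norm] at h3 ⊢
    rw [lt_div_iff₀ (by positivity)] at h3
    have h4 : ‖g k z - g l z‖ ≤ C * ‖u k - u l‖ := h1
    nlinarith [norm_nonneg (u k - u l), C.2]
  have hlim : ∀ z, ∃ y, z ∈ unitBall n → Tendsto (fun k => g k z) atTop (𝓝 y) := by
    intro z
    by_cases hz : z ∈ unitBall n
    · obtain ⟨ε, hε, -, hu⟩ := hb z hz
      obtain ⟨y, hy⟩ := cauchySeq_tendsto_of_complete (hu.cauchySeq (Metric.mem_ball_self hε))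
      exact ⟨y, fun _ => hy⟩
    · exact ⟨0, fun h => absurd h hz⟩
  choose G hG using hlim
  refine ⟨G, fun z₀ hz₀ => ?_, ?_⟩
  · obtain ⟨ε, hε, hεU, hu⟩ := hb z₀ hz₀
    have hd : ∀ k, ∀ x ∈ Metric.ball z₀ (ε / 2), HasFDerivAt (g k) (fderiv ℂ (g k) x) x := by
      intro k x hx
      have hxU : x ∈ unitBall n := hεU (Metric.ball_subset_ball (by linarith) hx)
      exact ((hg k).differentiableAt ((isOpen_unitBall n).mem_nhds hxU)).hasFDerivAt
    have hu' : UniformCauchySeqOn (fun k => fderiv ℂ (g k)) atTop (Metric.ball z₀ (ε / 2)) := by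
      refine Metric.uniformCauchySeqOn_iff.mpr fun η hη => ?_
      obtain ⟨N, hN⟩ := Metric.uniformCauchySeqOn_iff.mp hu (η * ε / 8) (by positivity)
      refine ⟨N, fun k hk l hl x hx => ?_⟩
      have hxb : Metric.ball x (ε / 2) ⊆ Metric.ball z₀ ε := by
        intro w hw
        rw [Metric.mem_ball] at hw hx ⊢
        linarith [dist_triangle w x z₀]
      have hxx := hxb (Metric.mem_ball_self (by positivity))
      rw [dist_eq_norm, ← fderiv_sub (hd k x hx).differentiableAt (hd l x hx).differentiableAt]
      have := Complex.norm_fderiv_le_div_of_mapsTo_ball (f := g k - g l) (c := x)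
        (R₁ := ε / 2) (R₂ := η * ε / 4) (((hg k).sub (hg l)).mono (hxb.trans hεU)) ?_
        (by positivity)
      · refine this.trans_lt ?_
        rw [div_lt_iff₀ (by positivity)]
        nlinarith [mul_pos hη hε]
      · intro w hw
        have e1 := hN k hk l hl w (hxb hw)
        have e2 := hN k hk l hl x hxx
        rw [dist_eq_norm] at e1 e2
        rw [mem_closedBall_iff_norm]
        refine (norm_sub_le _ _).trans ?_
        simp only [Pi.sub_apply]
        linarith
    have hlim' : ∀ x, ∃ L, x ∈ Metric.ball z₀ (ε / 2) →
        Tendsto (fun k => fderiv ℂ (g k) x) atTop (𝓝 L) := by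
      intro x
      by_cases hx : x ∈ Metric.ball z₀ (ε / 2)
      · obtain ⟨L, hL⟩ := cauchySeq_tendsto_of_complete (hu'.cauchySeq hx)
        exact ⟨L, fun _ => hL⟩
      · exact ⟨0, fun h => absurd h hx⟩
    choose L hL using hlim'
    exact (hasFDerivAt_of_tendstoUniformlyOn Metric.isOpen_ball
      (hu'.tendstoUniformlyOn_of_tendsto hL) hd
      (fun x hx => hG x (hεU (Metric.ball_subset_ball (by linarith) hx)))
      (Metric.mem_ball_self (by positivity))).differentiableAt.differentiableWithinAt
  · obtain ⟨ns, hns, hae⟩ := (tendstoInMeasure_of_tendsto_Lp huf).exists_seq_tendsto_ae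
    filter_upwards [hae, ae_mem_unitBall n α, ae_all_iff.mpr hgu] with z h1 h2 h3
    refine tendsto_nhds_unique h1 ?_
    simp only [h3]
    exact (hG z h2).comp hns.tendsto_atTop

instance instCompleteSpaceBergmanSpace (n : ℕ) (α : ℝ) : CompleteSpace (bergmanSpace n α) :=
  (isClosed_bergmanSpace n α).completeSpace_coe


/-! ### Symbols and Toeplitz operators -/

/-- `p` is a profile of `a`: `a(z) = p(|z₁|, …, |zₙ|)` for almost every `z` in the ball. -/
def IsProfile {n : ℕ} (a : (Fin n → ℂ) → ℂ) (p : (Fin n → ℝ) → ℂ) : Prop :=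
  Measurable p ∧ ∀ᵐ z ∂volume.restrict (unitBall n), a z = p (fun i => ‖z i‖)

/-- Alternating separately radial symbols: bounded symbols which depend almost everywhere only on
`(|z₁|, …, |zₙ|)` and are almost everywhere invariant under even permutations of coordinates. -/
def IsAlternatingSeparatelyRadial {n : ℕ} (a : (Fin n → ℂ) → ℂ) : Prop :=
  MemLp a ⊤ (volume.restrict (unitBall n)) ∧
  (∃ p : (Fin n → ℝ) → ℂ, IsProfile a p) ∧
  ∀ σ ∈ alternatingGroup (Fin n),
    ∀ᵐ z ∂volume.restrict (unitBall n), a (fun i => z (σ i)) = a z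

/-- `T` is the Toeplitz operator with symbol `a` on the weighted Bergman space:
`(T f)(z) = ∫ a(w) f(w) (1 - z·w̄)^{-(n+α+1)} dv_α(w)`. -/
def IsToeplitzOperator {n : ℕ} {α : ℝ} (a : (Fin n → ℂ) → ℂ)
    (T : bergmanSpace n α →L[ℂ] bergmanSpace n α) : Prop :=
  ∀ f : bergmanSpace n α, ∀ᵐ z ∂weightedMeasure n α,
    (T f : Lp ℂ 2 (weightedMeasure n α)) z =
      ∫ w, a w * (f : Lp ℂ 2 (weightedMeasure n α)) w *
        (1 - ∑ i, z i * (starRingEnd ℂ) (w i)) ^ (-((n : ℂ) + (α : ℂ) + 1))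
        ∂weightedMeasure n α

/-- The (norm closed, unital) C*-algebra generated by a set of bounded operators. -/
def generatedCStarAlgebra {H : Type*} [NormedAddCommGroup H] [InnerProductSpace ℂ H]
    [CompleteSpace H] (S : Set (H →L[ℂ] H)) : StarSubalgebra ℂ (H →L[ℂ] H) :=
  (StarAlgebra.adjoin ℂ S).topologicalClosure

/-- The C*-algebra generated by the Toeplitz operators with alternating separately radial symbols. -/
def alternatingToeplitzAlgebra (n : ℕ) (α : ℝ) :
    StarSubalgebra ℂ (bergmanSpace n α →L[ℂ] bergmanSpace n α) :=
  generatedCStarAlgebra {T | ∃ a : (Fin n → ℂ) → ℂ,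
    IsAlternatingSeparatelyRadial a ∧ IsToeplitzOperator a T}

/-! ### Multi-indices -/

/-- The action `σ(ι) = (ι_{σ(1)}, …, ι_{σ(n)})` on multi-indices. -/
def permIndex {n : ℕ} (σ : Equiv.Perm (Fin n)) (ι : Fin n → ℕ) : Fin n → ℕ := fun i => ι (σ i)

/-- `𝓘⁰`: the non-increasing multi-indices with a repeated entry. -/
def repeatedIndices (n : ℕ) : Set (Fin n → ℕ) :=
  {ι | Antitone ι ∧ ∃ i j, i ≠ j ∧ ι i = ι j}

/-- `𝓘ᶜ`: the strictly decreasing multi-indices. -/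
def strictIndices (n : ℕ) : Set (Fin n → ℕ) := {ι | StrictAnti ι}

/-- `𝓘_ι`: all permutations of `ι`. -/
def permOrbit {n : ℕ} (ι : Fin n → ℕ) : Set (Fin n → ℕ) :=
  {m | ∃ σ : Equiv.Perm (Fin n), m = permIndex σ ι}

/-- `𝓘_ι⁺`: the even permutations of `ι`. -/
def evenOrbit {n : ℕ} (ι : Fin n → ℕ) : Set (Fin n → ℕ) :=
  {m | ∃ σ ∈ alternatingGroup (Fin n), m = permIndex σ ι}

/-- `𝓘_ι⁻`: the odd permutations of `ι`. -/
def oddOrbit {n : ℕ} (ι : Fin n → ℕ) : Set (Fin n → ℕ) :=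
  {m | ∃ σ ∉ alternatingGroup (Fin n), m = permIndex σ ι}

/-! ### The sequence space and the diagonalising unitary -/

/-- `ℓ²(ℤ₊ⁿ)`. -/
abbrev EllTwo (n : ℕ) : Type := lp (fun _ : Fin n → ℕ => ℂ) 2

/-- `ℓ²(S)` inside `ℓ²(ℤ₊ⁿ)`: the sequences vanishing outside `S`. -/
def ellTwoOn {n : ℕ} (S : Set (Fin n → ℕ)) : Submodule ℂ (EllTwo n) where
  carrier := {x | ∀ m ∉ S, x m = 0}
  zero_mem' := fun _ _ => rfl
  add_mem' := fun {x y} hx hy m hm => by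
    rw [lp.coeFn_add, Pi.add_apply, hx m hm, hy m hm, add_zero]
  smul_mem' := fun c x hx m hm => by
    rw [lp.coeFn_smul, Pi.smul_apply, hx m hm, smul_zero]

/-- The index sets of the blocks: `𝓘_ι` for `ι ∈ 𝓘⁰`, then `𝓘_ι⁺` and `𝓘_ι⁻` for `ι ∈ 𝓘ᶜ`. -/
def blockIndices (n : ℕ) :
    repeatedIndices n ⊕ (strictIndices n ⊕ strictIndices n) → Set (Fin n → ℕ)
  | .inl ι => permOrbit ι.1
  | .inr (.inl ι) => evenOrbit ι.1
  | .inr (.inr ι) => oddOrbit ι.1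

/-- The normalised monomials `e_m(z) = √(Γ(n+|m|+α+1) / (m! Γ(n+α+1))) z^m`. -/
def basisMonomial (n : ℕ) (α : ℝ) (m : Fin n → ℕ) (z : Fin n → ℂ) : ℂ :=
  (Real.sqrt (Real.Gamma (n + (∑ i, m i : ℕ) + α + 1) /
    ((∏ i, (m i).factorial : ℕ) * Real.Gamma (n + α + 1))) : ℂ) * ∏ i, z i ^ m i

/-- `R(f) = (⟨f, e_m⟩)_m`. -/
def IsCoefficientMap {n : ℕ} {α : ℝ} (R : bergmanSpace n α ≃ₗᵢ[ℂ] EllTwo n) : Prop :=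
  ∀ (f : bergmanSpace n α) (m : Fin n → ℕ),
    R f m = ∫ z, (f : Lp ℂ 2 (weightedMeasure n α)) z *
      (starRingEnd ℂ) (basisMonomial n α m z) ∂weightedMeasure n α

/-- `τ(𝔹ⁿ) = {(|z₁|, …, |zₙ|) : z ∈ 𝔹ⁿ}`. -/
def radialBase (n : ℕ) : Set (Fin n → ℝ) := {r | (∀ i, 0 ≤ r i) ∧ ∑ i, r i ^ 2 < 1}

/-- The spectral function
`γ(m) = 2ⁿ Γ(n+|m|+α+1) / (m! Γ(α+1)) ∫_{τ(𝔹ⁿ)} p(r) r^{2m} (1-|r|²)^α ∏ rₖ drₖ`. -/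
def spectralFunction {n : ℕ} (α : ℝ) (p : (Fin n → ℝ) → ℂ) (m : Fin n → ℕ) : ℂ :=
  ((2 ^ n * Real.Gamma (n + (∑ i, m i : ℕ) + α + 1) /
    ((∏ i, (m i).factorial : ℕ) * Real.Gamma (α + 1)) : ℝ) : ℂ) *
  ∫ r in radialBase n,
    p r * (((∏ i, r i ^ (2 * m i)) * (1 - ∑ i, r i ^ 2) ^ α * ∏ i, r i : ℝ) : ℂ)

end AltToeplitz

end

/-!
The normalised monomials `e_m` are orthonormal in `L²(v_α)`. Orthogonality comes from rotating a
single coordinate (`integral_radial_basisMonomial_ne`), and the same argument gives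
`∫ a e_k conj(e_m) dv_α = 0` for `k ≠ m` and every separately radial `a`. The norms come from the
complex form of Dirichlet's integral (`gamma_mul_lintegral_ball_monomial`), which a scaling of the
ball reduces to a product of Gaussian integrals.

The monomials are complete in the Bergman space. For `f` holomorphic on the ball, the Fourier
coefficients of `f` along the orbits of the torus are multiples of the monomials `z^m`, and vanish
unless `m ≥ 0` (`exists_orbitCoeff_eq`, `orbitCoeff_eq_zero_of_neg`). If `f` is orthogonal to all
`e_m`, these multiples are zero, hence `f` vanishes by uniqueness of Fourier series on the torus
(`eq_zero_of_orthogonal_basisMonomial`). So `R` is the unitary of a Hilbert basis.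

The Bergman kernel `(1 - z·w̄)^{-(n+α+1)}` is the sum of the series `∑ e_m(z) conj(e_m(w))`
(`hasSum_basisMonomial_mul_conj`), a multivariate binomial series obtained by integrating the
exponential series against the Gamma density. Hence integration against the kernel is the
orthogonal projection onto the Bergman space, and the formula for `T_a` describes the compression of
the multiplication by `a` (`isToeplitzOperator_toeplitz`). For radial `a` this compression is
diagonal in the basis `e_m`, with eigenvalues `∫ a |e_m|² dv_α` (`repr_toeplitz_of_isProfile`); in
polar coordinates these are the values `γ_a(m)` of the spectral function
(`symbolMean_eq_spectralFunction`). Operators which are diagonal in a common basis generate a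
commutative C*-algebra (`commute_of_mem_generatedCStarAlgebra`).

Finally, the invariance of `a` under even permutations makes `γ_a` constant on even orbits
(`symbolMean_permIndex`). A multi-index with a repeated entry is fixed by a transposition, so that
its whole orbit is an even orbit; the orbit of a strictly decreasing multi-index splits into an even
and an odd part. These orbits partition the multi-indices, which gives the Hilbert sum.
-/

noncomputable section

namespace AltToeplitz

/-! ### Dirichlet's integral over the ball -/

theorem lintegral_gamma {x : ℝ} (hx : 0 < x) :
    ∫⁻ s in Ioi (0 : ℝ), ENNReal.ofReal (s ^ (x - 1) * Real.exp (-s)) =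
      ENNReal.ofReal (Real.Gamma x) := by
  have h := Real.GammaIntegral_convergent hx
  rw [Real.Gamma_eq_integral hx]
  rw [ofReal_integral_eq_lintegral_ofReal h]
  · simp only [mul_comm]
  · filter_upwards [ae_restrict_mem measurableSet_Ioi] with s hs
    have : (0 : ℝ) < s := hs
    positivity

theorem lintegral_gaussian_monomial {n : ℕ} (m : Fin n → ℕ) :
    ∫⁻ w : Fin n → ℂ, ENNReal.ofReal
        ((∏ i, ‖w i‖ ^ (2 * m i)) * Real.exp (-∑ i, ‖w i‖ ^ 2)) =
      ENNReal.ofReal (∏ i, (Real.pi * (m i).factorial)) := by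
  have h1 : ∀ k : ℕ, ∫ x : ℂ, ‖x‖ ^ (2 * k) * Real.exp (-‖x‖ ^ 2) = Real.pi * k.factorial := by
    intro k
    have := Complex.integral_rpow_mul_exp_neg_rpow (p := 2) (q := (2 * k : ℕ)) (by norm_num)
      (by have : (0 : ℝ) ≤ (2 * k : ℕ) := by positivity
          linarith)
    simp only [Real.rpow_natCast, Real.rpow_two] at this
    rw [this]
    have h2 : (((2 * k : ℕ) : ℝ) + 2) / 2 = k + 1 := by push_cast; ring
    rw [h2, Real.Gamma_nat_eq_factorial]
    ring
  have hi : ∀ k : ℕ, Integrable (fun x : ℂ => ‖x‖ ^ (2 * k) * Real.exp (-‖x‖ ^ 2)) := by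
    intro k
    refine Integrable.of_integral_ne_zero ?_
    rw [h1]
    positivity
  have h2 : ∀ w : Fin n → ℂ, (∏ i, ‖w i‖ ^ (2 * m i)) * Real.exp (-∑ i, ‖w i‖ ^ 2) =
      ∏ i, (‖w i‖ ^ (2 * m i) * Real.exp (-‖w i‖ ^ 2)) := by
    intro w
    rw [Finset.prod_mul_distrib, ← Real.exp_sum, Finset.sum_neg_distrib]
  simp only [h2]
  rw [← ofReal_integral_eq_lintegral_ofReal]
  · rw [volume_pi, integral_fintype_prod_eq_prod (𝕜 := ℝ)
      (fun i (x : ℂ) => ‖x‖ ^ (2 * m i) * Real.exp (-‖x‖ ^ 2))]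
    simp only [h1]
  · exact Integrable.fintype_prod (fun i => hi (m i))
  · exact ae_of_all _ fun w => Finset.prod_nonneg fun i _ => by positivity

theorem lintegral_comp_real_smul {n : ℕ} {f : (Fin n → ℂ) → ℝ≥0∞} (hf : Measurable f)
    {r : ℝ} (hr : 0 < r) :
    ENNReal.ofReal (r ^ (2 * n)) * ∫⁻ z, f (r • z) = ∫⁻ w, f w := by
  have h := Measure.map_addHaar_smul (volume : Measure (Fin n → ℂ)) hr.ne'
  have hd : Module.finrank ℝ (Fin n → ℂ) = 2 * n := by
    rw [Module.finrank_pi_fintype]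
    simp [Complex.finrank_real_complex, mul_comm]
  rw [hd] at h
  have h2 : ∫⁻ z, f (r • z) = ∫⁻ w, f w ∂(Measure.map (r • ·) volume) :=
    (lintegral_map hf (by fun_prop)).symm
  rw [h2, h, lintegral_smul_measure, abs_of_pos (by positivity), smul_eq_mul, ← mul_assoc,
    ← ENNReal.ofReal_mul (by positivity), mul_inv_cancel₀ (by positivity), ENNReal.ofReal_one,
    one_mul]

/-- The complex form of Dirichlet's integral. Both sides are multiplied by a Gamma function:
after scaling the ball to radius `√s`, integrating against `e^{-s}` and exchanging the order of
integration, the left-hand side becomes a product of Gaussian integrals. -/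
theorem gamma_mul_lintegral_ball_monomial {n : ℕ} {α : ℝ} (hα : -1 < α) (m : Fin n → ℕ) :
    ENNReal.ofReal (Real.Gamma (n + (∑ i, m i : ℕ) + α + 1)) *
      ∫⁻ z in unitBall n, ENNReal.ofReal
        ((∏ i, ‖z i‖ ^ (2 * m i)) * (1 - ∑ i, ‖z i‖ ^ 2) ^ α) =
    ENNReal.ofReal (Real.Gamma (α + 1)) * ENNReal.ofReal (∏ i, (Real.pi * (m i).factorial)) := by
  classical
  set q : (Fin n → ℂ) → ℝ := fun w => ∑ i, ‖w i‖ ^ 2 with hq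
  set P : (Fin n → ℂ) → ℝ := fun w => ∏ i, ‖w i‖ ^ (2 * m i) with hP
  have hqm : Measurable q := by fun_prop
  have hPm : Measurable P := by fun_prop
  have hP0 : ∀ w, 0 ≤ P w := fun w => Finset.prod_nonneg fun i _ => by positivity
  have hq0 : ∀ w, 0 ≤ q w := fun w => Finset.sum_nonneg fun i _ => by positivity
  set F : ℝ → (Fin n → ℂ) → ℝ≥0∞ := fun s w =>
    if q w < s then ENNReal.ofReal (P w * (s - q w) ^ α * Real.exp (-s)) else 0 with hF
  have hFm : Measurable (Function.uncurry F) := by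
    refine Measurable.ite (measurableSet_lt (by fun_prop) (by fun_prop)) ?_ measurable_const
    fun_prop
  have hFs : ∀ s, Measurable (F s) := fun s =>
    Measurable.ite (measurableSet_lt (by fun_prop) (by fun_prop)) (by fun_prop) measurable_const
  have hx : (0 : ℝ) < n + (∑ i, m i : ℕ) + α + 1 := by
    have : (0 : ℝ) ≤ n + (∑ i, m i : ℕ) := by positivity
    linarith
  have h1 : ∀ w, ∫⁻ s, F s w = ENNReal.ofReal (P w * Real.exp (-q w)) *
      ENNReal.ofReal (Real.Gamma (α + 1)) := by
    intro w
    rw [← lintegral_add_right_eq_self _ (q w), ← lintegral_gamma (by linarith),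
      ← lintegral_const_mul' _ _ ENNReal.ofReal_ne_top, ← lintegral_indicator measurableSet_Ioi]
    refine lintegral_congr fun s => ?_
    simp only [hF, indicator_apply, mem_Ioi, lt_add_iff_pos_left]
    split_ifs with hs
    · rw [← ENNReal.ofReal_mul (mul_nonneg (hP0 w) (Real.exp_pos _).le)]
      congr 1
      rw [add_sub_cancel_right, add_sub_cancel_right, neg_add, Real.exp_add]
      ring
    · rfl
  have h2 : ∀ s, ∫⁻ w, F s w = (Ioi (0 : ℝ)).indicator (fun s =>
      ENNReal.ofReal (s ^ ((n + (∑ i, m i : ℕ) + α + 1) - 1) * Real.exp (-s))) s *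
      ∫⁻ z in unitBall n, ENNReal.ofReal (P z * (1 - q z) ^ α) := by
    intro s
    rcases le_or_gt s 0 with hs | hs
    · rw [indicator_of_notMem (by simpa using hs), zero_mul]
      refine (lintegral_congr fun w => ?_).trans lintegral_zero
      exact if_neg (not_lt.mpr (hs.trans (hq0 w)))
    · rw [indicator_of_mem (by simpa using hs),
        ← lintegral_comp_real_smul (f := F s) (hFs s) (Real.sqrt_pos.mpr hs),
        ← lintegral_const_mul' _ _ ENNReal.ofReal_ne_top,
        ← lintegral_const_mul' _ _ ENNReal.ofReal_ne_top,
        ← lintegral_indicator (isOpen_unitBall n).measurableSet]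
      refine lintegral_congr fun z => ?_
      have e1 : q (Real.sqrt s • z) = s * q z := by
        simp only [hq, Pi.smul_apply, norm_smul, mul_pow, Finset.mul_sum]
        simp [Real.sq_sqrt hs.le]
      have e2 : P (Real.sqrt s • z) = s ^ (∑ i, m i) * P z := by
        simp only [hP, Pi.smul_apply, norm_smul, mul_pow, Finset.prod_mul_distrib,
          ← Finset.prod_pow_eq_pow_sum]
        simp [pow_mul, Real.sq_sqrt hs.le]
      have e3 : z ∈ unitBall n ↔ s * q z < s := by
        rw [mul_lt_iff_lt_one_right hs]; rfl
      simp only [hF, indicator_apply, e1, e2, e3]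
      split_ifs with hz
      · rw [← ENNReal.ofReal_mul (by positivity), ← ENNReal.ofReal_mul (by positivity)]
        congr 1
        have hz1 : 0 ≤ 1 - q z := by nlinarith
        have e4 : s - s * q z = s * (1 - q z) := by ring
        have e5 : ((n : ℝ) + (∑ i, m i : ℕ) + α + 1) - 1 =
            ((n + ∑ i, m i : ℕ) : ℝ) + α := by push_cast; ring
        rw [e4, Real.mul_rpow hs.le hz1, e5, Real.rpow_add hs, Real.rpow_natCast, pow_add,
          pow_mul, Real.sq_sqrt hs.le]
        ring
      · simp
  have h3 := lintegral_lintegral_swap (μ := volume) (ν := volume) (f := F) hFm.aemeasurable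
  simp only [h1, h2] at h3
  rw [lintegral_mul_const _ (Measurable.indicator (by fun_prop) measurableSet_Ioi),
    lintegral_mul_const' _ _ ENNReal.ofReal_ne_top, lintegral_indicator measurableSet_Ioi,
    lintegral_gamma hx, lintegral_gaussian_monomial] at h3
  rw [h3, mul_comm]

/-! ### The weighted measure -/

/-- The weight with respect to Lebesgue measure, all constants collected. -/
def ballWeight (n : ℕ) (α : ℝ) (z : Fin n → ℂ) : ℝ :=
  Real.Gamma (n + α + 1) / (Real.pi ^ n * Real.Gamma (α + 1)) * (1 - ∑ i, ‖z i‖ ^ 2) ^ α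

theorem measurable_ballWeight (n : ℕ) (α : ℝ) : Measurable (ballWeight n α) := by
  unfold ballWeight
  fun_prop

theorem ballWeight_nonneg {n : ℕ} {α : ℝ} (hα : -1 < α) {z : Fin n → ℂ} (hz : z ∈ unitBall n) :
    0 ≤ ballWeight n α z := by
  have h1 : 0 < Real.Gamma (n + α + 1) :=
    Real.Gamma_pos_of_pos (by have : (0 : ℝ) ≤ n := n.cast_nonneg; linarith)
  have h2 : 0 < Real.Gamma (α + 1) := Real.Gamma_pos_of_pos (by linarith)
  have h3 : 0 ≤ 1 - ∑ i, ‖z i‖ ^ 2 := (sub_pos.mpr hz).le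
  unfold ballWeight
  positivity

theorem weightedMeasure_eq (n : ℕ) (α : ℝ) :
    weightedMeasure n α =
      (volume.restrict (unitBall n)).withDensity fun z => ENNReal.ofReal (ballWeight n α z) := by
  rw [weightedMeasure, ballMeasure, withDensity_smul_measure, ← withDensity_smul]
  · congr 1
    funext z
    rw [Pi.smul_apply, smul_eq_mul, ← ENNReal.ofReal_mul (by positivity)]
    congr 1
    have : (n.factorial : ℝ) ≠ 0 := by positivity
    unfold weightConst ballWeight
    field_simp
  · fun_prop

theorem weightedMeasure_absolutelyContinuous (n : ℕ) (α : ℝ) :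
    weightedMeasure n α ≪ volume.restrict (unitBall n) := by
  rw [weightedMeasure_eq]
  exact withDensity_absolutelyContinuous _ _

theorem integral_weightedMeasure {n : ℕ} {α : ℝ} (hα : -1 < α) (f : (Fin n → ℂ) → ℂ) :
    ∫ z, f z ∂weightedMeasure n α = ∫ z in unitBall n, (ballWeight n α z : ℂ) * f z := by
  rw [weightedMeasure_eq, integral_withDensity_eq_integral_toReal_smul
    (measurable_ballWeight n α).ennreal_ofReal (ae_of_all _ fun _ => ENNReal.ofReal_lt_top)]
  refine setIntegral_congr_fun (isOpen_unitBall n).measurableSet fun z hz => ?_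
  simp only [ENNReal.toReal_ofReal (ballWeight_nonneg hα hz), Complex.real_smul]

theorem lintegral_weightedMeasure_monomial {n : ℕ} {α : ℝ} (hα : -1 < α) (m : Fin n → ℕ) :
    ∫⁻ z, ENNReal.ofReal (∏ i, ‖z i‖ ^ (2 * m i)) ∂weightedMeasure n α =
      ENNReal.ofReal ((∏ i, (m i).factorial : ℕ) * Real.Gamma (n + α + 1) /
        Real.Gamma (n + (∑ i, m i : ℕ) + α + 1)) := by
  have hn : (0 : ℝ) ≤ n := n.cast_nonneg
  have hx : (0 : ℝ) < n + (∑ i, m i : ℕ) + α + 1 := by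
    have : (0 : ℝ) ≤ (∑ i, m i : ℕ) := by positivity
    linarith
  have g1 : 0 < Real.Gamma (n + α + 1) := Real.Gamma_pos_of_pos (by linarith)
  have g2 : 0 < Real.Gamma (α + 1) := Real.Gamma_pos_of_pos (by linarith)
  have g3 := Real.Gamma_pos_of_pos hx
  rw [weightedMeasure_eq, lintegral_withDensity_eq_lintegral_mul _
    (measurable_ballWeight n α).ennreal_ofReal (by fun_prop)]
  have e : ∀ z ∈ unitBall n, ((fun z => ENNReal.ofReal (ballWeight n α z)) *
      fun z : Fin n → ℂ => ENNReal.ofReal (∏ i, ‖z i‖ ^ (2 * m i))) z =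
      ENNReal.ofReal (Real.Gamma (n + α + 1) / (Real.pi ^ n * Real.Gamma (α + 1))) *
      ENNReal.ofReal ((∏ i, ‖z i‖ ^ (2 * m i)) * (1 - ∑ i, ‖z i‖ ^ 2) ^ α) := by
    intro z hz
    rw [Pi.mul_apply, ← ENNReal.ofReal_mul (ballWeight_nonneg hα hz),
      ← ENNReal.ofReal_mul (by positivity)]
    congr 1
    unfold ballWeight
    ring
  rw [setLIntegral_congr_fun (isOpen_unitBall n).measurableSet e,
    lintegral_const_mul' _ _ ENNReal.ofReal_ne_top]
  have h := gamma_mul_lintegral_ball_monomial hα m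
  rw [← ENNReal.ofReal_mul g2.le] at h
  have h' := (ENNReal.eq_div_iff (by simpa using g3) ENNReal.ofReal_ne_top).mpr h
  rw [h', ← ENNReal.ofReal_div_of_pos g3, ← ENNReal.ofReal_mul (by positivity)]
  congr 1
  rw [Finset.prod_mul_distrib, Finset.prod_const, Finset.card_univ, Fintype.card_fin]
  push_cast
  field_simp

theorem isProbabilityMeasure_weightedMeasure (n : ℕ) {α : ℝ} (hα : -1 < α) :
    IsProbabilityMeasure (weightedMeasure n α) := by
  have h := lintegral_weightedMeasure_monomial hα (0 : Fin n → ℕ)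
  have g1 : 0 < Real.Gamma (n + α + 1) :=
    Real.Gamma_pos_of_pos (by have : (0 : ℝ) ≤ n := n.cast_nonneg; linarith)
  constructor
  simpa [g1.ne'] using h

/-- Volume preserving maps which preserve the Euclidean norm preserve the weighted measure. -/
theorem measurePreserving_weightedMeasure {n : ℕ} (α : ℝ) {φ : (Fin n → ℂ) → (Fin n → ℂ)}
    (hφ : MeasurePreserving φ) (hn : ∀ z, ∑ i, ‖φ z i‖ ^ 2 = ∑ i, ‖z i‖ ^ 2) :
    MeasurePreserving φ (weightedMeasure n α) (weightedMeasure n α) := by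
  refine ⟨hφ.measurable, Measure.ext fun s hs => ?_⟩
  have hU := (isOpen_unitBall n).measurableSet
  have hpre : φ ⁻¹' unitBall n = unitBall n := by
    ext z
    simp only [unitBall, mem_preimage, mem_ofPred_eq, hn]
  have hm := (measurable_ballWeight n α).ennreal_ofReal
  rw [Measure.map_apply hφ.measurable hs, weightedMeasure_eq,
    withDensity_apply _ (hφ.measurable hs), withDensity_apply _ hs,
    Measure.restrict_restrict hs, Measure.restrict_restrict (hφ.measurable hs),
    ← hφ.setLIntegral_comp_preimage (hs.inter hU) hm, preimage_inter, hpre]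
  refine lintegral_congr fun z => ?_
  simp only [ballWeight, hn]

/-- The rotation of the coordinates by unimodular numbers. -/
theorem measurePreserving_torus {n : ℕ} {c : Fin n → ℂ} (hc : ∀ i, ‖c i‖ = 1) :
    MeasurePreserving (fun z : Fin n → ℂ => fun i => c i * z i) := by
  have h : ∀ i, MeasurePreserving (fun x : ℂ => c i * x) := fun i =>
    (rotation ⟨c i, mem_sphere_zero_iff_norm.mpr (hc i)⟩).measurePreserving
  exact volume_preserving_pi h

theorem measurePreserving_torus_weightedMeasure {n : ℕ} (α : ℝ) {c : Fin n → ℂ}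
    (hc : ∀ i, ‖c i‖ = 1) :
    MeasurePreserving (fun z : Fin n → ℂ => fun i => c i * z i)
      (weightedMeasure n α) (weightedMeasure n α) :=
  measurePreserving_weightedMeasure α (measurePreserving_torus hc)
    (fun z => by simp only [norm_mul, hc, one_mul])

theorem measurePreserving_perm {n : ℕ} (σ : Equiv.Perm (Fin n)) :
    MeasurePreserving (fun z : Fin n → ℂ => fun i => z (σ i)) := by
  have := volume_measurePreserving_piCongrLeft (fun _ : Fin n => ℂ) σ⁻¹
  have e : (fun z : Fin n → ℂ => fun i => z (σ i)) =
      MeasurableEquiv.piCongrLeft (fun _ : Fin n => ℂ) σ⁻¹ := by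
    funext z i
    have h := Equiv.piCongrLeft_apply_apply (P := fun _ : Fin n => ℂ) σ⁻¹ z (σ i)
    rw [MeasurableEquiv.coe_piCongrLeft]
    simpa using h.symm
  rw [e]
  exact this

theorem measurePreserving_perm_weightedMeasure {n : ℕ} (α : ℝ) (σ : Equiv.Perm (Fin n)) :
    MeasurePreserving (fun z : Fin n → ℂ => fun i => z (σ i))
      (weightedMeasure n α) (weightedMeasure n α) :=
  measurePreserving_weightedMeasure α (measurePreserving_perm σ)
    (fun z => Equiv.sum_comp σ (fun i => ‖z i‖ ^ 2))

/-! ### Orthonormality of the monomials -/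

/-- The square of the normalising factor of the monomial `e_m`. -/
def monomialFactor (n : ℕ) (α : ℝ) (m : Fin n → ℕ) : ℝ :=
  Real.Gamma (n + (∑ i, m i : ℕ) + α + 1) /
    ((∏ i, (m i).factorial : ℕ) * Real.Gamma (n + α + 1))

theorem monomialFactor_pos {n : ℕ} {α : ℝ} (hα : -1 < α) (m : Fin n → ℕ) :
    0 < monomialFactor n α m := by
  have hn : (0 : ℝ) ≤ n := n.cast_nonneg
  have hx : (0 : ℝ) ≤ (∑ i, m i : ℕ) := by positivity
  have h1 : 0 < Real.Gamma (n + (∑ i, m i : ℕ) + α + 1) :=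
    Real.Gamma_pos_of_pos (by linarith)
  have h2 : 0 < Real.Gamma (n + α + 1) := Real.Gamma_pos_of_pos (by linarith)
  have h3 : 0 < (∏ i, (m i).factorial) := Finset.prod_pos fun i _ => (m i).factorial_pos
  unfold monomialFactor
  positivity

theorem basisMonomial_eq (n : ℕ) (α : ℝ) (m : Fin n → ℕ) (z : Fin n → ℂ) :
    basisMonomial n α m z = (Real.sqrt (monomialFactor n α m) : ℂ) * ∏ i, z i ^ m i := rfl

theorem differentiable_basisMonomial (n : ℕ) (α : ℝ) (m : Fin n → ℕ) :
    Differentiable ℂ (basisMonomial n α m) := by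
  have : basisMonomial n α m = fun z =>
      (Real.sqrt (monomialFactor n α m) : ℂ) * ∏ i, z i ^ m i := rfl
  rw [this]
  fun_prop

theorem measurable_basisMonomial (n : ℕ) (α : ℝ) (m : Fin n → ℕ) :
    Measurable (basisMonomial n α m) :=
  (differentiable_basisMonomial n α m).continuous.measurable

theorem norm_basisMonomial_sq {n : ℕ} {α : ℝ} (hα : -1 < α) (m : Fin n → ℕ) (z : Fin n → ℂ) :
    ‖basisMonomial n α m z‖ ^ 2 = monomialFactor n α m * ∏ i, ‖z i‖ ^ (2 * m i) := by
  rw [basisMonomial_eq, norm_mul, norm_prod, mul_pow, Complex.norm_real, Real.norm_eq_abs, sq_abs,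
    Real.sq_sqrt (monomialFactor_pos hα m).le, ← Finset.prod_pow]
  congr 1
  refine Finset.prod_congr rfl fun i _ => ?_
  rw [norm_pow, ← pow_mul, mul_comm]

theorem basisMonomial_mul_conj {n : ℕ} {α : ℝ} (hα : -1 < α) (m : Fin n → ℕ) (z : Fin n → ℂ) :
    basisMonomial n α m z * (starRingEnd ℂ) (basisMonomial n α m z) =
      ((monomialFactor n α m * ∏ i, ‖z i‖ ^ (2 * m i) : ℝ) : ℂ) := by
  rw [Complex.mul_conj, Complex.normSq_eq_norm_sq, norm_basisMonomial_sq hα]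

theorem lintegral_enorm_basisMonomial_sq {n : ℕ} {α : ℝ} (hα : -1 < α) (m : Fin n → ℕ) :
    ∫⁻ z, ENNReal.ofReal (‖basisMonomial n α m z‖ ^ 2) ∂weightedMeasure n α = 1 := by
  have hn : (0 : ℝ) ≤ n := n.cast_nonneg
  have hx : (0 : ℝ) ≤ (∑ i, m i : ℕ) := by positivity
  have h1 : 0 < Real.Gamma (n + (∑ i, m i : ℕ) + α + 1) :=
    Real.Gamma_pos_of_pos (by linarith)
  have h2 : 0 < Real.Gamma (n + α + 1) := Real.Gamma_pos_of_pos (by linarith)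
  have h3 : (0 : ℝ) < (∏ i, (m i).factorial : ℕ) :=
    Nat.cast_pos.mpr (Finset.prod_pos fun i _ => (m i).factorial_pos)
  simp only [norm_basisMonomial_sq hα, ENNReal.ofReal_mul (monomialFactor_pos hα m).le]
  rw [lintegral_const_mul' _ _ ENNReal.ofReal_ne_top, lintegral_weightedMeasure_monomial hα,
    ← ENNReal.ofReal_mul (monomialFactor_pos hα m).le, ← ENNReal.ofReal_one]
  congr 1
  unfold monomialFactor
  field_simp

theorem memLp_basisMonomial {n : ℕ} {α : ℝ} (hα : -1 < α) (m : Fin n → ℕ) :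
    MemLp (basisMonomial n α m) 2 (weightedMeasure n α) := by
  have hm := (measurable_basisMonomial n α m).aestronglyMeasurable (μ := weightedMeasure n α)
  rw [memLp_two_iff_integrable_sq_norm hm]
  refine ⟨(hm.norm.pow 2), ?_⟩
  rw [hasFiniteIntegral_iff_ofReal (ae_of_all _ fun z => by positivity),
    lintegral_enorm_basisMonomial_sq hα]
  exact ENNReal.one_lt_top

theorem integral_norm_basisMonomial_sq {n : ℕ} {α : ℝ} (hα : -1 < α) (m : Fin n → ℕ) :
    ∫ z, ‖basisMonomial n α m z‖ ^ 2 ∂weightedMeasure n α = 1 := by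
  rw [integral_eq_lintegral_of_nonneg_ae (ae_of_all _ fun z => by positivity)
    (((measurable_basisMonomial n α m).norm.pow_const 2).aestronglyMeasurable),
    lintegral_enorm_basisMonomial_sq hα, ENNReal.toReal_one]

theorem basisMonomial_torus (n : ℕ) (α : ℝ) (m : Fin n → ℕ) (c z : Fin n → ℂ) :
    basisMonomial n α m (fun i => c i * z i) = (∏ i, c i ^ m i) * basisMonomial n α m z := by
  simp only [basisMonomial_eq, mul_pow, Finset.prod_mul_distrib]
  ring

/-- Distinct monomials are orthogonal with respect to every separately radial density: rotating a
single coordinate multiplies the integral by a number different from one. -/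
theorem integral_radial_basisMonomial_ne {n : ℕ} (α : ℝ) (p : (Fin n → ℝ) → ℂ)
    {m k : Fin n → ℕ} (h : m ≠ k) :
    ∫ z, p (fun i => ‖z i‖) * basisMonomial n α k z * (starRingEnd ℂ) (basisMonomial n α m z)
      ∂weightedMeasure n α = 0 := by
  classical
  obtain ⟨j, hj⟩ := Function.ne_iff.mp h
  set d : ℤ := (k j : ℤ) - m j with hd
  have hd0 : d ≠ 0 := by omega
  -- rotation by the angle `π / d` turns the sign of the integral
  set u : ℂ := Complex.exp (((Real.pi / d : ℝ) : ℂ) * Complex.I) with hu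
  have hun : ‖u‖ = 1 := Complex.norm_exp_ofReal_mul_I _
  have hu0 : u ≠ 0 := Complex.exp_ne_zero _
  set c : Fin n → ℂ := Function.update 1 j u with hc
  have hc1 : ∀ i, ‖c i‖ = 1 := by
    intro i
    rcases eq_or_ne i j with rfl | hi
    · simp [hc, hun]
    · simp [hc, hi]
  have hprod : ∀ l : Fin n → ℕ, ∏ i, c i ^ l i = u ^ l j := by
    intro l
    rw [Finset.prod_eq_single j]
    · simp [hc]
    · intro i _ hi
      simp [hc, hi]
    · simp
  have hk : u ^ k j * (starRingEnd ℂ) (u ^ m j) = -1 := by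
    have hinv : (starRingEnd ℂ) u = u⁻¹ := (Complex.inv_eq_conj hun).symm
    have : u ^ k j * (starRingEnd ℂ) (u ^ m j) = u ^ d := by
      rw [map_pow, hinv, hd, zpow_sub₀ hu0, inv_pow, div_eq_mul_inv]
      simp
    rw [this, hu, ← Complex.exp_int_mul]
    have hdc : (d : ℂ) ≠ 0 := by exact_mod_cast hd0
    have e : (d : ℂ) * (((Real.pi / d : ℝ) : ℂ) * Complex.I) = Real.pi * Complex.I := by
      push_cast
      field_simp
    rw [e, Complex.exp_pi_mul_I]
  have hmp := measurePreserving_torus_weightedMeasure α hc1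
  set I := ∫ z, p (fun i => ‖z i‖) * basisMonomial n α k z *
    (starRingEnd ℂ) (basisMonomial n α m z) ∂weightedMeasure n α with hI
  have hemb : MeasurableEmbedding (fun z : Fin n → ℂ => fun i => c i * z i) := by
    have h0 : ∀ i, c i ≠ 0 := fun i => norm_ne_zero_iff.mp (by rw [hc1]; exact one_ne_zero)
    exact (MeasurableEquiv.piCongrRight fun i =>
      (Homeomorph.mulLeft₀ (c i) (h0 i)).toMeasurableEquiv).measurableEmbedding
  have e := hmp.integral_comp hemb (fun z => p (fun i => ‖z i‖) * basisMonomial n α k z *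
    (starRingEnd ℂ) (basisMonomial n α m z))
  have e2 : I = -I := by
    rw [hI, ← integral_neg]
    conv_lhs => rw [← e]
    refine integral_congr_ae (ae_of_all _ fun z => ?_)
    simp only [basisMonomial_torus, norm_mul, hc1, one_mul, hprod, map_mul]
    linear_combination p (fun i => ‖z i‖) * basisMonomial n α k z *
      (starRingEnd ℂ) (basisMonomial n α m z) * hk
  exact self_eq_neg.mp e2

/-! ### Fourier coefficients on the torus -/

/-- The Fourier coefficients of a holomorphic function on circles around the origin, read off from
its power series. The constant `A` does not depend on the point `ζ`. -/
theorem exists_fourierCoeff_circle {h : ℂ → ℂ} {R : ℝ≥0} (hR : 0 < R)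
    (hd : DifferentiableOn ℂ h (Metric.closedBall 0 R)) (k : ℤ) :
    ∃ A : ℂ, ∀ ζ : ℂ, ‖ζ‖ < R →
      fourierCoeff (fun x : UnitAddCircle => h (fourier 1 x * ζ)) k =
        if 0 ≤ k then A * ζ ^ k.toNat else 0 := by
  have hp := hd.hasFPowerSeriesOnBall hR
  set P := cauchyPowerSeries h 0 R
  refine ⟨P.coeff k.toNat, fun ζ hζ => ?_⟩
  have hsum : Summable fun l => ‖P l‖ * ‖ζ‖ ^ l := by
    have := P.summable_norm_mul_pow (r := ‖ζ‖₊) (lt_of_lt_of_le (by exact_mod_cast hζ) hp.r_le)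
    simpa using this
  have hf1 : ∀ x : UnitAddCircle, ‖(fourier 1 x : ℂ)‖ = 1 := fun x => by
    rw [fourier_apply, Circle.norm_coe]
  have hfk : ∀ (l : ℕ) (x : UnitAddCircle), (fourier 1 x : ℂ) ^ l = fourier (l : ℤ) x := by
    intro l x
    rw [fourier_one, fourier_apply, natCast_zsmul, AddCircle.toCircle_nsmul, Circle.coe_pow]
  have hs := hasSum_integral_of_dominated_convergence
    (μ := (AddCircle.haarAddCircle : Measure UnitAddCircle))
    (F := fun (l : ℕ) (x : UnitAddCircle) =>
      fourier (-k) x • ((P.coeff l * ζ ^ l) * fourier (l : ℤ) x))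
    (f := fun x : UnitAddCircle => fourier (-k) x • h (fourier 1 x * ζ))
    (fun l _ => ‖P l‖ * ‖ζ‖ ^ l) ?_ ?_ ?_ ?_ ?_
  · have hc : ∀ l : ℕ, ∫ x : UnitAddCircle, fourier (-k) x •
        ((P.coeff l * ζ ^ l) * fourier (l : ℤ) x) ∂AddCircle.haarAddCircle =
        if (l : ℤ) = k then P.coeff l * ζ ^ l else 0 := by
      intro l
      have h1 := fourierCoeff.const_mul (T := 1) (fun x => fourier (l : ℤ) x)
        (P.coeff l * ζ ^ l) k
      have h2 : fourierCoeff (T := 1) (fun x => fourier (l : ℤ) x) k =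
          (Pi.single (l : ℤ) 1 : ℤ → ℂ) k := congrFun (fourierCoeff_fourier (T := 1) (l : ℤ)) k
      rw [h2, Pi.single_apply, mul_ite, mul_one, mul_zero] at h1
      simp only [eq_comm (a := k)] at h1
      exact h1
    simp only [hc] at hs
    refine hs.unique ?_
    split_ifs with hk
    · have e : (fun l : ℕ => if (l : ℤ) = k then P.coeff l * ζ ^ l else 0) =
          fun l => if l = k.toNat then P.coeff k.toNat * ζ ^ k.toNat else 0 := by
        funext l
        by_cases hl : l = k.toNat
        · rw [if_pos hl, if_pos (by omega), hl]
        · rw [if_neg hl, if_neg (by omega)]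
      rw [e]
      exact hasSum_ite_eq _ _
    · convert hasSum_zero using 2 with l
      rw [if_neg (by omega)]
  · intro l
    exact Continuous.aestronglyMeasurable (by fun_prop)
  · refine fun l => ae_of_all _ fun x => ?_
    rw [norm_smul, norm_mul, norm_mul, norm_pow]
    have e : ∀ j : ℤ, ‖(fourier j x : ℂ)‖ = 1 := fun j => by rw [fourier_apply, Circle.norm_coe]
    rw [e, e, one_mul, mul_one, P.norm_apply_eq_norm_coef]
  · exact ae_of_all _ fun _ => hsum
  · exact integrable_const _
  · refine ae_of_all _ fun x => ?_
    have hy : (fourier 1 x : ℂ) * ζ ∈ Metric.eball (0 : ℂ) R := by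
      rw [Metric.mem_eball, edist_zero_right, enorm_mul, ← ofReal_norm, ← ofReal_norm, hf1,
        ENNReal.ofReal_one, one_mul, ← ENNReal.ofReal_coe_nnreal]
      exact (ENNReal.ofReal_lt_ofReal_iff (by exact_mod_cast hR)).mpr hζ
    have := hp.hasSum hy
    simp only [FormalMultilinearSeries.apply_eq_pow_smul_coeff, zero_add] at this
    refine HasSum.const_smul _ ?_
    convert this using 2 with l
    rw [mul_pow, hfk, smul_eq_mul]
    ring

/-- Haar probability measure on the torus. -/
abbrev torusMeasure (n : ℕ) : Measure (UnitAddTorus (Fin n)) :=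
  Measure.pi fun _ => (AddCircle.haarAddCircle : Measure UnitAddCircle)

/-- The action of the torus on `ℂⁿ` by rotation of the coordinates. -/
def torusAct {n : ℕ} (t : UnitAddTorus (Fin n)) (z : Fin n → ℂ) : Fin n → ℂ :=
  fun i => fourier 1 (t i) * z i

theorem norm_torusAct {n : ℕ} (t : UnitAddTorus (Fin n)) (z : Fin n → ℂ) (i : Fin n) :
    ‖torusAct t z i‖ = ‖z i‖ := by
  rw [torusAct, norm_mul, fourier_apply, Circle.norm_coe, one_mul]

theorem torusAct_mem {n : ℕ} {t : UnitAddTorus (Fin n)} {z : Fin n → ℂ} :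
    torusAct t z ∈ unitBall n ↔ z ∈ unitBall n := by
  change (∑ i, ‖torusAct t z i‖ ^ 2 < 1) ↔ (∑ i, ‖z i‖ ^ 2 < 1)
  simp only [norm_torusAct]

theorem continuous_torusAct {n : ℕ} :
    Continuous fun p : UnitAddTorus (Fin n) × (Fin n → ℂ) => torusAct p.1 p.2 := by
  unfold torusAct
  fun_prop

theorem measurePreserving_torusAct {n : ℕ} (α : ℝ) (t : UnitAddTorus (Fin n)) :
    MeasurePreserving (torusAct t) (weightedMeasure n α) (weightedMeasure n α) :=
  measurePreserving_torus_weightedMeasure α (c := fun i => fourier 1 (t i))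
    (fun i => by rw [fourier_apply, Circle.norm_coe])

instance (n : ℕ) : IsProbabilityMeasure (torusMeasure n) := by
  unfold torusMeasure; infer_instance

instance (n : ℕ) : (torusMeasure n).IsAddRightInvariant := by
  unfold torusMeasure; infer_instance

/-- The Fourier coefficient of `f` along the torus orbit of `z`. -/
def orbitCoeff {n : ℕ} (f : (Fin n → ℂ) → ℂ) (m : Fin n → ℤ) (z : Fin n → ℂ) : ℂ :=
  UnitAddTorus.mFourierCoeff (fun t => f (torusAct t z)) m

theorem orbitCoeff_def {n : ℕ} (f : (Fin n → ℂ) → ℂ) (m : Fin n → ℤ) (z : Fin n → ℂ) :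
    orbitCoeff f m z =
      ∫ t, UnitAddTorus.mFourier (-m) t • f (torusAct t z) ∂torusMeasure n := rfl

theorem continuous_orbit {n : ℕ} {f : (Fin n → ℂ) → ℂ} (hf : ContinuousOn f (unitBall n))
    {z : Fin n → ℂ} (hz : z ∈ unitBall n) :
    Continuous fun t : UnitAddTorus (Fin n) => f (torusAct t z) :=
  hf.comp_continuous (continuous_torusAct.comp (Continuous.prodMk_left z))
    fun _ => torusAct_mem.mpr hz

theorem mFourier_add_single {n : ℕ} (m : Fin n → ℤ) (t : UnitAddTorus (Fin n)) (i : Fin n)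
    (x : UnitAddCircle) :
    UnitAddTorus.mFourier m (t + Pi.single i x) = fourier (m i) x * UnitAddTorus.mFourier m t := by
  have h : ∀ u : UnitAddTorus (Fin n), UnitAddTorus.mFourier m u = ∏ j, fourier (m j) (u j) :=
    fun _ => rfl
  have h1 : ∀ j, (fourier (m j) ((t + Pi.single i x : UnitAddTorus (Fin n)) j) : ℂ) =
      (if j = i then (fourier (m i) x : ℂ) else 1) * fourier (m j) (t j) := by
    intro j
    by_cases hj : j = i
    · subst hj
      simp only [fourier_apply, Pi.add_apply, Pi.single_eq_same, smul_add, AddCircle.toCircle_add,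
        Circle.coe_mul, if_true]
      ring
    · simp [hj]
  rw [h, h, Finset.prod_congr rfl fun j _ => h1 j, Finset.prod_mul_distrib]
  simp

theorem torusAct_add_single_update {n : ℕ} (t : UnitAddTorus (Fin n)) (i : Fin n)
    (x : UnitAddCircle) (z : Fin n → ℂ) (ζ : ℂ) :
    torusAct (t + Pi.single i x) (Function.update z i ζ) =
      Function.update (torusAct t z) i (fourier 1 (t i) * (fourier 1 x * ζ)) := by
  funext j
  by_cases hj : j = i
  · subst hj
    simp only [torusAct, Function.update_self, Pi.add_apply, Pi.single_eq_same, fourier_one,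
      AddCircle.toCircle_add, Circle.coe_mul]
    ring
  · simp [torusAct, hj]

/-- Averaging over an additional rotation of a single coordinate leaves the Fourier coefficient of
an orbit unchanged. -/
theorem orbitCoeff_update {n : ℕ} {f : (Fin n → ℂ) → ℂ} (hf : ContinuousOn f (unitBall n))
    (m : Fin n → ℤ) (z : Fin n → ℂ) (i : Fin n) (ζ : ℂ)
    (hz : Function.update z i ζ ∈ unitBall n) :
    orbitCoeff f m (Function.update z i ζ) =
      ∫ t, UnitAddTorus.mFourier (-m) t • fourierCoeff (fun x : UnitAddCircle =>
        f (Function.update (torusAct t z) i (fourier 1 (t i) * (fourier 1 x * ζ)))) (m i)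
        ∂torusMeasure n := by
  have h1 : ∀ x : UnitAddCircle, orbitCoeff f m (Function.update z i ζ) =
      ∫ t, UnitAddTorus.mFourier (-m) t • fourier (-(m i)) x •
        f (Function.update (torusAct t z) i (fourier 1 (t i) * (fourier 1 x * ζ)))
        ∂torusMeasure n := by
    intro x
    rw [orbitCoeff_def, ← integral_add_right_eq_self _ (Pi.single i x)]
    refine integral_congr_ae (ae_of_all _ fun t => ?_)
    simp only [mFourier_add_single, torusAct_add_single_update, Pi.neg_apply, smul_eq_mul]
    ring
  have h2 : orbitCoeff f m (Function.update z i ζ) =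
      ∫ _x : UnitAddCircle, orbitCoeff f m (Function.update z i ζ) ∂AddCircle.haarAddCircle := by
    simp
  rw [h2]
  conv_lhs => enter [2, x]; rw [h1 x]
  rw [integral_integral_swap]
  · simp only [integral_smul]
    rfl
  · have hc : Continuous (Function.uncurry fun (x : UnitAddCircle) (t : UnitAddTorus (Fin n)) =>
        UnitAddTorus.mFourier (-m) t • (fourier (-(m i)) x : ℂ) •
        f (Function.update (torusAct t z) i (fourier 1 (t i) * (fourier 1 x * ζ)))) := by
      have e : Continuous fun p : UnitAddCircle × UnitAddTorus (Fin n) =>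
          f (Function.update (torusAct p.2 z) i (fourier 1 (p.2 i) * (fourier 1 p.1 * ζ))) := by
        simp only [← torusAct_add_single_update]
        refine hf.comp_continuous (continuous_torusAct.comp (Continuous.prodMk ?_
          continuous_const)) fun p => torusAct_mem.mpr hz
        exact continuous_snd.add ((continuous_single i).comp continuous_fst)
      exact ((UnitAddTorus.mFourier (-m)).continuous.comp continuous_snd).smul
        (((fourier (-(m i))).continuous.comp continuous_fst).smul e)
    exact hc.integrable_of_hasCompactSupport (HasCompactSupport.of_compactSpace _)

theorem sum_norm_update {n : ℕ} (z : Fin n → ℂ) (i : Fin n) (ζ : ℂ) :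
    ∑ j, ‖Function.update z i ζ j‖ ^ 2 = ‖ζ‖ ^ 2 + ∑ j ∈ Finset.univ.erase i, ‖z j‖ ^ 2 := by
  rw [← Finset.add_sum_erase _ _ (Finset.mem_univ i), Function.update_self]
  congr 1
  refine Finset.sum_congr rfl fun j hj => ?_
  rw [Function.update_of_ne (Finset.ne_of_mem_erase hj)]

/-- Along each coordinate, the Fourier coefficient of an orbit is a monomial. -/
theorem orbitCoeff_update_mul {n : ℕ} {f : (Fin n → ℂ) → ℂ}
    (hf : DifferentiableOn ℂ f (unitBall n)) (m : Fin n → ℤ) (z : Fin n → ℂ) (i : Fin n)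
    {ζ ζ' : ℂ} (hz : Function.update z i ζ ∈ unitBall n)
    (hz' : Function.update z i ζ' ∈ unitBall n) :
    ζ' ^ (m i).toNat * orbitCoeff f m (Function.update z i ζ) =
      ζ ^ (m i).toNat * orbitCoeff f m (Function.update z i ζ') ∧
    (m i < 0 → orbitCoeff f m (Function.update z i ζ) = 0) := by
  obtain ⟨w, hw, hζw, hζw'⟩ : ∃ w : ℂ, Function.update z i w ∈ unitBall n ∧
      ‖ζ‖ ≤ ‖w‖ ∧ ‖ζ'‖ ≤ ‖w‖ := by
    rcases le_total ‖ζ‖ ‖ζ'‖ with h | h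
    · exact ⟨ζ', hz', h, le_rfl⟩
    · exact ⟨ζ, hz, le_rfl, h⟩
  -- a radius `R` slightly larger than `‖w‖`
  obtain ⟨R, hwR, hR⟩ : ∃ R : ℝ, ‖w‖ < R ∧
      R ^ 2 + ∑ j ∈ Finset.univ.erase i, ‖z j‖ ^ 2 < 1 := by
    have hw1 : ‖w‖ ^ 2 + ∑ j ∈ Finset.univ.erase i, ‖z j‖ ^ 2 < 1 := by
      rw [← sum_norm_update]; exact hw
    have hc : ContinuousAt (fun R : ℝ => R ^ 2 + ∑ j ∈ Finset.univ.erase i, ‖z j‖ ^ 2) ‖w‖ := by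
      fun_prop
    have h1 := (hc.eventually_lt continuousAt_const hw1).filter_mono
      (nhdsWithin_le_nhds (s := Ioi ‖w‖))
    exact (eventually_mem_nhdsWithin.and h1).exists
  have hR0 : 0 < R := (norm_nonneg _).trans_lt hwR
  have key : ∀ t : UnitAddTorus (Fin n), ∃ A : ℂ, ∀ ξ : ℂ, ‖ξ‖ ≤ ‖w‖ →
      fourierCoeff (fun x : UnitAddCircle =>
        f (Function.update (torusAct t z) i (fourier 1 (t i) * (fourier 1 x * ξ)))) (m i) =
        if 0 ≤ m i then A * ξ ^ (m i).toNat else 0 := by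
    intro t
    obtain ⟨A, hA⟩ := exists_fourierCoeff_circle (R := ⟨R, hR0.le⟩)
      (h := fun ξ => f (Function.update (torusAct t z) i (fourier 1 (t i) * ξ)))
      (by exact_mod_cast hR0) (hf.comp (s := Metric.closedBall (0 : ℂ) R) (by
        refine Differentiable.differentiableOn ?_
        refine differentiable_pi.mpr fun j => ?_
        by_cases hj : j = i
        · subst hj
          simp only [Function.update_self]
          fun_prop
        · simp only [Function.update_of_ne hj]
          fun_prop) (fun ξ hξ => by
        change ∑ j, ‖Function.update (torusAct t z) i (fourier 1 (t i) * ξ) j‖ ^ 2 < 1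
        rw [sum_norm_update, norm_mul, fourier_apply, Circle.norm_coe, one_mul]
        simp only [norm_torusAct]
        rw [mem_closedBall_zero_iff] at hξ
        refine lt_of_le_of_lt ?_ hR
        gcongr)) (m i)
    exact ⟨A, fun ξ hξ => hA ξ (hξ.trans_lt hwR)⟩
  choose A hA using key
  rw [orbitCoeff_update hf.continuousOn m z i ζ hz, orbitCoeff_update hf.continuousOn m z i ζ' hz']
  simp only [hA _ _ hζw, hA _ _ hζw']
  split_ifs with h
  · refine ⟨?_, fun h' => absurd h' (not_lt.mpr h)⟩
    rw [← integral_const_mul, ← integral_const_mul]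
    refine integral_congr_ae (ae_of_all _ fun t => ?_)
    simp only [smul_eq_mul]
    ring
  · simp

theorem orbitCoeff_eq_zero_of_neg {n : ℕ} {f : (Fin n → ℂ) → ℂ}
    (hf : DifferentiableOn ℂ f (unitBall n)) {m : Fin n → ℤ} {i : Fin n} (hi : m i < 0)
    {z : Fin n → ℂ} (hz : z ∈ unitBall n) : orbitCoeff f m z = 0 := by
  have hz' : Function.update z i (z i) ∈ unitBall n := by rwa [Function.update_eq_self]
  have h := (orbitCoeff_update_mul hf m z i hz' hz').2 hi
  rwa [Function.update_eq_self] at h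

/-- The coordinates of `z` can be replaced by those of `v` one after the other without leaving the
ball. -/
theorem orbitCoeff_mul {n : ℕ} {f : (Fin n → ℂ) → ℂ} (hf : DifferentiableOn ℂ f (unitBall n))
    (m : Fin n → ℤ) {z v : Fin n → ℂ} (h : ∑ i, max ‖z i‖ ‖v i‖ ^ 2 < 1) :
    (∏ i, v i ^ (m i).toNat) * orbitCoeff f m z =
      (∏ i, z i ^ (m i).toNat) * orbitCoeff f m v := by
  classical
  have hmem : ∀ u : Fin n → ℂ, (∀ i, ‖u i‖ ≤ max ‖z i‖ ‖v i‖) → u ∈ unitBall n := fun u hu =>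
    lt_of_le_of_lt (Finset.sum_le_sum fun i _ => pow_le_pow_left₀ (norm_nonneg _) (hu i) 2) h
  have hpw : ∀ (s : Finset (Fin n)) i, ‖s.piecewise v z i‖ ≤ max ‖z i‖ ‖v i‖ := by
    intro s i
    by_cases hi : i ∈ s
    · simp [hi]
    · simp [hi]
  have key : ∀ s : Finset (Fin n), (∏ i ∈ s, v i ^ (m i).toNat) * orbitCoeff f m z =
      (∏ i ∈ s, z i ^ (m i).toNat) * orbitCoeff f m (s.piecewise v z) := by
    intro s
    induction s using Finset.induction_on with
    | empty => simp
    | insert j s hj ih =>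
      have e1 : Function.update (s.piecewise v z) j (z j) = s.piecewise v z := by
        rw [← Finset.piecewise_eq_of_notMem s v z hj, Function.update_eq_self]
      have h1 : Function.update (s.piecewise v z) j (z j) ∈ unitBall n := by
        rw [e1]
        exact hmem _ (hpw s)
      have h2 : Function.update (s.piecewise v z) j (v j) ∈ unitBall n := by
        rw [← Finset.piecewise_insert]
        exact hmem _ (hpw _)
      have h3 := (orbitCoeff_update_mul hf m (s.piecewise v z) j h1 h2).1
      rw [e1] at h3
      rw [Finset.prod_insert hj, Finset.prod_insert hj, Finset.piecewise_insert, mul_assoc, ih]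
      linear_combination (∏ i ∈ s, z i ^ (m i).toNat) * h3
  have := key Finset.univ
  rwa [Finset.piecewise_univ] at this

theorem exists_pos_sum_max_lt {n : ℕ} {z : Fin n → ℂ} (hz : z ∈ unitBall n) {η : ℝ} (hη : 0 < η) :
    ∃ δ : ℝ, 0 < δ ∧ δ < η ∧ ∑ i, max ‖z i‖ δ ^ 2 < 1 := by
  have hc : ContinuousAt (fun δ : ℝ => ∑ i, max ‖z i‖ δ ^ 2) 0 := by fun_prop
  have h0 : (∑ i, max ‖z i‖ 0 ^ 2) < 1 := by
    simp only [max_eq_left (norm_nonneg _)]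
    exact hz
  have h1 := (hc.eventually_lt continuousAt_const h0).filter_mono
    (nhdsWithin_le_nhds (s := Ioi 0))
  have h2 : ∀ᶠ δ : ℝ in 𝓝[>] 0, δ < η := (eventually_lt_nhds hη).filter_mono nhdsWithin_le_nhds
  obtain ⟨δ, a, b, c⟩ := (eventually_mem_nhdsWithin.and (h1.and h2)).exists
  exact ⟨δ, a, c, b⟩

/-- The Fourier coefficients of the torus orbits of a holomorphic function on the ball are
monomials: this is the multivariate Taylor expansion of the function. -/
theorem exists_orbitCoeff_eq {n : ℕ} {f : (Fin n → ℂ) → ℂ}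
    (hf : DifferentiableOn ℂ f (unitBall n)) (m : Fin n → ℤ) :
    ∃ c : ℂ, ∀ z ∈ unitBall n, orbitCoeff f m z = c * ∏ i, z i ^ (m i).toNat := by
  have h0 : (0 : Fin n → ℂ) ∈ unitBall n := by
    change ∑ i : Fin n, ‖(0 : Fin n → ℂ) i‖ ^ 2 < 1
    simp
  obtain ⟨ε, hε, -, hεs⟩ := exists_pos_sum_max_lt h0 one_pos
  simp only [Pi.zero_apply, norm_zero, max_eq_right hε.le] at hεs
  set e : Fin n → ℂ := fun _ => (ε : ℂ) with he
  have hne : ∀ {x : ℝ}, 0 < x → (∏ i, (x : ℂ) ^ (m i).toNat) ≠ 0 := by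
    intro x hx
    exact Finset.prod_ne_zero_iff.mpr fun i _ => pow_ne_zero _ (by exact_mod_cast hx.ne')
  refine ⟨orbitCoeff f m e / ∏ i, e i ^ (m i).toNat, fun z hz => ?_⟩
  obtain ⟨δ, hδ, hδε, hδs⟩ := exists_pos_sum_max_lt hz hε
  -- compare both `z` and the reference point with a point on the diagonal close to the origin
  set d : Fin n → ℂ := fun _ => (δ : ℂ) with hd
  have h1 := orbitCoeff_mul hf m (z := z) (v := d)
    (by simpa [hd, abs_of_pos hδ] using hδs)
  have h2 := orbitCoeff_mul hf m (z := e) (v := d)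
    (by simpa [hd, he, abs_of_pos hδ, abs_of_pos hε, max_eq_left hδε.le] using hεs)
  have hd0 : (∏ i, d i ^ (m i).toNat) ≠ 0 := hne hδ
  have he0 : (∏ i, e i ^ (m i).toNat) ≠ 0 := hne hε
  rw [div_mul_eq_mul_div, eq_div_iff he0]
  refine mul_left_cancel₀ hd0 ?_
  linear_combination (∏ i, e i ^ (m i).toNat) * h1 - (∏ i, z i ^ (m i).toNat) * h2

/-! ### Completeness of the monomials -/

theorem conj_basisMonomial_torusAct {n : ℕ} (α : ℝ) (m : Fin n → ℕ) (t : UnitAddTorus (Fin n))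
    (z : Fin n → ℂ) : (starRingEnd ℂ) (basisMonomial n α m (torusAct t z)) =
      UnitAddTorus.mFourier (-(fun i => (m i : ℤ))) t *
        (starRingEnd ℂ) (basisMonomial n α m z) := by
  have h := basisMonomial_torus n α m (fun i => fourier 1 (t i)) z
  have h2 : ∏ i, (fourier 1 (t i) : ℂ) ^ m i = UnitAddTorus.mFourier (fun i => (m i : ℤ)) t := by
    change _ = ∏ i, (fourier (m i : ℤ) (t i) : ℂ)
    refine Finset.prod_congr rfl fun i _ => ?_
    rw [fourier_one, fourier_apply, natCast_zsmul, AddCircle.toCircle_nsmul, Circle.coe_pow]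
  rw [UnitAddTorus.mFourier_neg, ← map_mul, ← h2, ← h]
  rfl

/-- A holomorphic function on the ball which is orthogonal to all monomials vanishes. -/
theorem eq_zero_of_orthogonal_basisMonomial {n : ℕ} {α : ℝ} (hα : -1 < α)
    {f : (Fin n → ℂ) → ℂ} (hf : DifferentiableOn ℂ f (unitBall n))
    (hL : MemLp f 2 (weightedMeasure n α))
    (h : ∀ m : Fin n → ℕ,
      ∫ z, f z * (starRingEnd ℂ) (basisMonomial n α m z) ∂weightedMeasure n α = 0)
    {z : Fin n → ℂ} (hz : z ∈ unitBall n) : f z = 0 := by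
  have := isProbabilityMeasure_weightedMeasure n hα
  -- all Fourier coefficients of all orbits vanish
  have hcoef : ∀ m : Fin n → ℤ, ∀ z ∈ unitBall n, orbitCoeff f m z = 0 := by
    intro m
    by_cases hm : ∃ i, m i < 0
    · obtain ⟨i, hi⟩ := hm
      exact fun z hz => orbitCoeff_eq_zero_of_neg hf hi hz
    push Not at hm
    set k : Fin n → ℕ := fun i => (m i).toNat with hk
    have hmk : m = fun i => (k i : ℤ) := funext fun i => (Int.toNat_of_nonneg (hm i)).symm
    obtain ⟨c, hc⟩ := exists_orbitCoeff_eq hf m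
    have hG : Integrable (fun z => f z * (starRingEnd ℂ) (basisMonomial n α k z))
        (weightedMeasure n α) :=
      hL.integrable_mul (memLp_basisMonomial hα k).star
    have hskew : MeasurePreserving (fun p : UnitAddTorus (Fin n) × (Fin n → ℂ) =>
        (p.1, torusAct p.1 p.2)) ((torusMeasure n).prod (weightedMeasure n α))
        ((torusMeasure n).prod (weightedMeasure n α)) :=
      (MeasurePreserving.id _).skew_product (g := torusAct) continuous_torusAct.measurable
        (ae_of_all _ fun t => (measurePreserving_torusAct α t).map_eq)
    -- integrate over the torus the orthogonality relation for the rotated function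
    have hint := (hskew.integrable_comp (hG.comp_snd (torusMeasure n)).aestronglyMeasurable).mpr
      (hG.comp_snd (torusMeasure n))
    have h1 : ∀ t : UnitAddTorus (Fin n), ∫ z, f (torusAct t z) *
        (starRingEnd ℂ) (basisMonomial n α k (torusAct t z)) ∂weightedMeasure n α = 0 := by
      intro t
      have := integral_map (measurePreserving_torusAct α t).measurable.aemeasurable
        (f := fun z => f z * (starRingEnd ℂ) (basisMonomial n α k z))
        (by rw [(measurePreserving_torusAct α t).map_eq]; exact hG.aestronglyMeasurable)
      rw [(measurePreserving_torusAct α t).map_eq, h k] at this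
      exact this.symm
    have h2 := integral_integral_swap (f := fun (t : UnitAddTorus (Fin n)) (z : Fin n → ℂ) =>
      f (torusAct t z) * (starRingEnd ℂ) (basisMonomial n α k (torusAct t z))) hint
    simp only [h1, integral_zero] at h2
    have h3 : ∀ z ∈ unitBall n, ∫ t, f (torusAct t z) *
        (starRingEnd ℂ) (basisMonomial n α k (torusAct t z)) ∂torusMeasure n =
        c / (Real.sqrt (monomialFactor n α k) : ℂ) * ((‖basisMonomial n α k z‖ ^ 2 : ℝ) : ℂ) := by
      intro z hz
      have e1 : ∫ t, f (torusAct t z) *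
          (starRingEnd ℂ) (basisMonomial n α k (torusAct t z)) ∂torusMeasure n =
          orbitCoeff f m z * (starRingEnd ℂ) (basisMonomial n α k z) := by
        rw [orbitCoeff_def, ← integral_mul_const]
        refine integral_congr_ae (ae_of_all _ fun t => ?_)
        simp only [conj_basisMonomial_torusAct, ← hmk, smul_eq_mul]
        ring
      have e2 : (Real.sqrt (monomialFactor n α k) : ℂ) ≠ 0 := by
        exact_mod_cast (Real.sqrt_pos.mpr (monomialFactor_pos hα k)).ne'
      have e3 : orbitCoeff f m z =
          c / (Real.sqrt (monomialFactor n α k) : ℂ) * basisMonomial n α k z := by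
        rw [hc z hz, basisMonomial_eq, ← mul_assoc, div_mul_cancel₀ _ e2]
      rw [e1, e3, ← Complex.normSq_eq_norm_sq, ← Complex.mul_conj, mul_assoc]
    have h4 : (0 : ℂ) = c / (Real.sqrt (monomialFactor n α k) : ℂ) := by
      rw [h2, integral_congr_ae ((ae_mem_unitBall n α).mono h3), integral_const_mul,
        integral_complex_ofReal, integral_norm_basisMonomial_sq hα]
      simp
    have hc0 : c = 0 := by
      have e2 : (Real.sqrt (monomialFactor n α k) : ℂ) ≠ 0 := by
        exact_mod_cast (Real.sqrt_pos.mpr (monomialFactor_pos hα k)).ne'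
      exact (div_eq_zero_iff.mp h4.symm).resolve_right e2
    intro z hz
    rw [hc z hz, hc0, zero_mul]
  have hF : ∀ m, UnitAddTorus.mFourierCoeff
      (⟨_, continuous_orbit hf.continuousOn hz⟩ : C(UnitAddTorus (Fin n), ℂ)) m = 0 :=
    fun m => hcoef m z hz
  have hsum : Summable (UnitAddTorus.mFourierCoeff
      (⟨_, continuous_orbit hf.continuousOn hz⟩ : C(UnitAddTorus (Fin n), ℂ))) :=
    summable_zero.congr fun m => (hF m).symm
  have h5 := UnitAddTorus.hasSum_mFourier_series_apply_of_summable hsum 0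
  simp only [hF, zero_smul] at h5
  have h6 := h5.unique hasSum_zero
  have h7 : torusAct (0 : UnitAddTorus (Fin n)) z = z := by
    funext i
    simp [torusAct]
  simpa [h7] using h6

/-! ### The series of the Bergman kernel -/

/-- The product of finitely many absolutely convergent series is the sum over multi-indices. -/
theorem hasSum_multiindex_prod {n : ℕ} (f : Fin n → ℕ → ℂ) (hf : ∀ i, Summable fun k => ‖f i k‖) :
    HasSum (fun m : Fin n → ℕ => ∏ i, f i (m i)) (∏ i, ∑' k, f i k) ∧
      Summable fun m : Fin n → ℕ => ‖∏ i, f i (m i)‖ := by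
  induction n with
  | zero =>
    refine ⟨?_, (hasSum_fintype _).summable⟩
    simp
  | succ n ih =>
    obtain ⟨h1, h2⟩ := ih (fun i => f i.succ) (fun i => hf i.succ)
    have hs := summable_mul_of_summable_norm (hf 0) h2
    have hn := (hf 0).mul_norm h2
    have h3 := ((hf 0).of_norm.hasSum).mul h1 hs
    have e : (fun p : ℕ × (Fin n → ℕ) => f 0 p.1 * ∏ i, f i.succ (p.2 i)) =
        (fun m : Fin (n + 1) → ℕ => ∏ i, f i (m i)) ∘ Fin.consEquiv (fun _ => ℕ) := by
      funext p
      simp [Fin.prod_univ_succ, Fin.consEquiv]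
    rw [e] at h3
    rw [Fin.prod_univ_succ]
    refine ⟨(Equiv.hasSum_iff _).mp h3, ?_⟩
    have e' : (fun p : ℕ × (Fin n → ℕ) => ‖f 0 p.1 * ∏ i, f i.succ (p.2 i)‖) =
        (fun m : Fin (n + 1) → ℕ => ‖∏ i, f i (m i)‖) ∘ Fin.consEquiv (fun _ => ℕ) := by
      funext p
      simp [Fin.prod_univ_succ, Fin.consEquiv]
    rw [e'] at hn
    exact (Equiv.summable_iff _).mp hn

theorem hasSum_multiindex_exp {n : ℕ} (x : Fin n → ℂ) :
    HasSum (fun m : Fin n → ℕ => ∏ i, (x i ^ m i / (m i).factorial)) (Complex.exp (∑ i, x i)) := by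
  have h := (hasSum_multiindex_prod (fun i k => x i ^ k / (k.factorial : ℂ)) (fun i => by
    simpa using (NormedSpace.norm_expSeries_div_summable (x i)))).1
  have e : ∀ i, ∑' k : ℕ, x i ^ k / (k.factorial : ℂ) = Complex.exp (x i) := by
    intro i
    rw [Complex.exp_eq_exp_ℂ, NormedSpace.exp_eq_tsum_div]
  simp only [e] at h
  rwa [← Complex.exp_sum] at h

theorem hasSum_multiindex_exp_real {n : ℕ} (y : Fin n → ℝ) :
    HasSum (fun m : Fin n → ℕ => ∏ i, (y i ^ m i / (m i).factorial)) (Real.exp (∑ i, y i)) := by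
  have h := hasSum_multiindex_exp (fun i => (y i : ℂ))
  refine Complex.hasSum_ofReal.mp ?_
  push_cast
  exact h

/-- The multivariate series of the Laplace transform of the Gamma density `t ^ (s - 1) e ^ (-t)`. -/
theorem hasSum_gamma_laplace {d : ℕ} {s : ℝ} (hs : 0 < s) {x : Fin d → ℂ}
    (hx : ∑ i, ‖x i‖ < 1) :
    HasSum (fun m : Fin d → ℕ =>
        (Real.Gamma (s + (∑ i, m i : ℕ)) : ℂ) * ∏ i, (x i ^ m i / (m i).factorial))
      (∫ t in Ioi (0 : ℝ), ((t ^ (s - 1) * Real.exp (-t) : ℝ) : ℂ) *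
        Complex.exp (t * ∑ i, x i)) := by
  have hsum := hasSum_integral_of_dominated_convergence (μ := volume.restrict (Ioi (0 : ℝ)))
    (F := fun (m : Fin d → ℕ) (t : ℝ) => ((t ^ (s - 1) * Real.exp (-t) : ℝ) : ℂ) *
      ∏ i, ((t * x i) ^ m i / (m i).factorial))
    (f := fun t : ℝ => ((t ^ (s - 1) * Real.exp (-t) : ℝ) : ℂ) *
      Complex.exp (∑ i, t * x i))
    (fun m t => (t ^ (s - 1) * Real.exp (-t)) * ∏ i, ((t * ‖x i‖) ^ m i / (m i).factorial))
    ?_ ?_ ?_ ?_ ?_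
  · have h0 : ∀ k : ℕ, ∫ t in Ioi (0 : ℝ), ((t ^ (s - 1) * Real.exp (-t) * t ^ k : ℝ) : ℂ) =
        Real.Gamma (s + k) := by
      intro k
      rw [integral_complex_ofReal, Real.Gamma_eq_integral (by positivity)]
      congr 1
      refine setIntegral_congr_fun measurableSet_Ioi fun t ht => ?_
      have e : s + k - 1 = (s - 1) + k := by ring
      have ht' : (0 : ℝ) < t := ht
      change _ = Real.exp (-t) * t ^ (s + k - 1)
      rw [e, Real.rpow_add ht', Real.rpow_natCast]
      ring
    have h1 : ∀ m : Fin d → ℕ, ∫ t in Ioi (0 : ℝ), ((t ^ (s - 1) * Real.exp (-t) : ℝ) : ℂ) *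
        ∏ i, ((t * x i) ^ m i / (m i).factorial) =
        Real.Gamma (s + (∑ i, m i : ℕ)) * ∏ i, (x i ^ m i / (m i).factorial) := by
      intro m
      have e : ∀ t : ℝ, ((t ^ (s - 1) * Real.exp (-t) : ℝ) : ℂ) *
          ∏ i, ((t * x i) ^ m i / (m i).factorial) =
          ((t ^ (s - 1) * Real.exp (-t) * t ^ (∑ i, m i) : ℝ) : ℂ) *
            ∏ i, (x i ^ m i / (m i).factorial) := by
        intro t
        simp only [mul_pow, mul_div_assoc]
        rw [Finset.prod_mul_distrib, Finset.prod_pow_eq_pow_sum]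
        push_cast
        ring
      simp only [e]
      rw [integral_mul_const, h0]
    simpa only [h1, Finset.mul_sum] using hsum
  · intro m
    exact Measurable.aestronglyMeasurable (by fun_prop)
  · intro m
    filter_upwards [ae_restrict_mem measurableSet_Ioi] with t ht
    have ht' : (0 : ℝ) < t := ht
    rw [norm_mul, norm_prod, Complex.norm_real, Real.norm_of_nonneg (by positivity)]
    simp [abs_of_pos ht']
  · exact ae_of_all _ fun t => (hasSum_multiindex_exp_real _).summable.mul_left _
  · simp only [tsum_mul_left, (hasSum_multiindex_exp_real _).tsum_eq]
    have h5 := integrableOn_rpow_mul_exp_neg_mul_rpow (p := 1) (s := s - 1)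
      (b := 1 - ∑ i, ‖x i‖) (by linarith) one_pos (by linarith)
    refine h5.congr_fun (fun t _ => ?_) measurableSet_Ioi
    simp only [Real.rpow_one]
    rw [mul_assoc, ← Real.exp_add, ← Finset.mul_sum]
    congr 2
    ring
  · exact ae_of_all _ fun t => (hasSum_multiindex_exp _).mul_left _

theorem gamma_add_nat_eq {s : ℝ} (hs : 0 < s) (k : ℕ) :
    (Real.Gamma (s + k) : ℂ) =
      Real.Gamma s * ((k.factorial : ℂ) * Ring.choose ((s : ℂ) + k - 1) k) := by
  have hne : ∀ j : ℕ, (s : ℂ) ≠ -j := by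
    intro j h
    have h' : s = -(j : ℝ) := by exact_mod_cast h
    have : (0 : ℝ) ≤ j := j.cast_nonneg
    linarith
  have hg : (Real.Gamma s : ℂ) ≠ 0 := by exact_mod_cast (Real.Gamma_pos_of_pos hs).ne'
  have h := Complex.Gamma_add_nat_div_Gamma_eq (n := k) (s : ℂ) hne
  have h2 : (k.factorial : ℂ) * Ring.choose ((s : ℂ) + k - 1) k =
      (ascPochhammer ℂ k).eval (s : ℂ) := by
    have h3 := Ring.factorial_nsmul_multichoose_eq_ascPochhammer (s : ℂ) k
    rw [Polynomial.ascPochhammer_smeval_eq_eval, nsmul_eq_mul] at h3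
    rw [← h3, Ring.choose]
    congr 2
    ring
  rw [h2, ← h, ← Complex.Gamma_ofReal, ← Complex.Gamma_ofReal]
  rw [← Complex.Gamma_ofReal] at hg
  push_cast
  field_simp

/-- The Laplace transform of the Gamma density at complex arguments in the unit disc. Its series in
one variable is the binomial series. -/
theorem integral_gamma_laplace {s : ℝ} (hs : 0 < s) {u : ℂ} (hu : ‖u‖ < 1) :
    ∫ t in Ioi (0 : ℝ), ((t ^ (s - 1) * Real.exp (-t) : ℝ) : ℂ) * Complex.exp (t * u) =
      Real.Gamma s * (1 - u) ^ (-(s : ℂ)) := by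
  have h1 := hasSum_gamma_laplace hs (x := fun _ : Fin 1 => u) (by simpa using hu)
  have h2 := (Complex.one_div_one_sub_cpow_hasFPowerSeriesOnBall_zero (s : ℂ)).hasSum (y := u)
    (by simpa [← ofReal_norm] using hu)
  have h3 := h2.mul_left (Real.Gamma s : ℂ)
  rw [zero_add, one_div, ← Complex.cpow_neg] at h3
  rw [← (Equiv.funUnique (Fin 1) ℕ).hasSum_iff] at h3
  simp only [Finset.univ_unique, Finset.sum_singleton, Finset.prod_singleton] at h1
  refine h1.unique (h3.congr_fun fun m => ?_)
  have hk := gamma_add_nat_eq hs (m 0)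
  have hf : ((m 0).factorial : ℂ) ≠ 0 := by exact_mod_cast (m 0).factorial_ne_zero
  simp only [Function.comp, Equiv.funUnique_apply, FormalMultilinearSeries.ofScalars_apply_eq,
    Fin.default_eq_zero, smul_eq_mul]
  rw [hk]
  field_simp

/-- The multivariate binomial series with exponent `-(n + α + 1)`. -/
theorem hasSum_monomialFactor {n : ℕ} {α : ℝ} (hα : -1 < α) {x : Fin n → ℂ}
    (hx : ∑ i, ‖x i‖ < 1) :
    HasSum (fun m : Fin n → ℕ => (monomialFactor n α m : ℂ) * ∏ i, x i ^ m i)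
      ((1 - ∑ i, x i) ^ (-((n : ℂ) + (α : ℂ) + 1))) := by
  have hn : (0 : ℝ) ≤ n := n.cast_nonneg
  have hs : 0 < n + α + 1 := by linarith
  have hgc : (Real.Gamma (n + α + 1) : ℂ) ≠ 0 := by
    exact_mod_cast (Real.Gamma_pos_of_pos hs).ne'
  have h := hasSum_gamma_laplace hs hx
  rw [integral_gamma_laplace hs ((norm_sum_le _ _).trans_lt hx)] at h
  have h4 := h.mul_left ((Real.Gamma (n + α + 1) : ℂ)⁻¹)
  rw [inv_mul_cancel_left₀ hgc] at h4
  push_cast at h4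
  refine h4.congr_fun fun m => ?_
  have e : (n : ℝ) + α + 1 + (∑ i, m i : ℕ) = n + (∑ i, m i : ℕ) + α + 1 := by ring
  have hf : (∏ i, ((m i).factorial : ℂ)) ≠ 0 :=
    Finset.prod_ne_zero_iff.mpr fun i _ => by exact_mod_cast (m i).factorial_ne_zero
  rw [← Nat.cast_sum, e, Finset.prod_div_distrib]
  unfold monomialFactor
  push_cast
  field_simp

theorem sum_norm_mul_le {n : ℕ} {z w : Fin n → ℂ} (hw : w ∈ unitBall n) :
    ∑ i, ‖z i‖ * ‖w i‖ ≤ (∑ i, ‖z i‖ ^ 2 + 1) / 2 := by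
  have hw' : ∑ i, ‖w i‖ ^ 2 < 1 := hw
  have h : ∑ i, ‖z i‖ * ‖w i‖ ≤ ∑ i, (‖z i‖ ^ 2 + ‖w i‖ ^ 2) / 2 :=
    Finset.sum_le_sum fun i _ => by nlinarith [sq_nonneg (‖z i‖ - ‖w i‖)]
  rw [← Finset.sum_div, Finset.sum_add_distrib] at h
  linarith

theorem sum_norm_mul_lt_one {n : ℕ} {z w : Fin n → ℂ} (hz : z ∈ unitBall n)
    (hw : w ∈ unitBall n) : ∑ i, ‖z i‖ * ‖w i‖ < 1 := by
  have hz' : ∑ i, ‖z i‖ ^ 2 < 1 := hz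
  linarith [sum_norm_mul_le (z := z) hw]

/-- The expansion of the Bergman kernel in the normalised monomials. -/
theorem hasSum_basisMonomial_mul_conj {n : ℕ} {α : ℝ} (hα : -1 < α) {z w : Fin n → ℂ}
    (hz : z ∈ unitBall n) (hw : w ∈ unitBall n) :
    HasSum (fun m => basisMonomial n α m z * (starRingEnd ℂ) (basisMonomial n α m w))
      ((1 - ∑ i, z i * (starRingEnd ℂ) (w i)) ^ (-((n : ℂ) + (α : ℂ) + 1))) := by
  have h := hasSum_monomialFactor hα (x := fun i => z i * (starRingEnd ℂ) (w i))
    (by simpa using sum_norm_mul_lt_one hz hw)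
  refine h.congr_fun fun m => ?_
  have e : (Real.sqrt (monomialFactor n α m) : ℂ) * Real.sqrt (monomialFactor n α m) =
      monomialFactor n α m := by
    exact_mod_cast Real.mul_self_sqrt (monomialFactor_pos hα m).le
  simp only [basisMonomial_eq, map_mul, map_prod, map_pow, Complex.conj_ofReal, mul_pow,
    Finset.prod_mul_distrib]
  rw [← e]
  ring

theorem hasSum_norm_basisMonomial_mul {n : ℕ} {α : ℝ} (hα : -1 < α) {z w : Fin n → ℂ}
    (hz : z ∈ unitBall n) (hw : w ∈ unitBall n) :
    HasSum (fun m => ‖basisMonomial n α m z‖ * ‖basisMonomial n α m w‖)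
      ((1 - ∑ i, ‖z i‖ * ‖w i‖) ^ (-(n + α + 1))) := by
  have h := hasSum_monomialFactor hα (x := fun i => ((‖z i‖ * ‖w i‖ : ℝ) : ℂ))
    (by simpa using sum_norm_mul_lt_one hz hw)
  have e1 : (1 - ∑ i, ((‖z i‖ * ‖w i‖ : ℝ) : ℂ)) ^ (-((n : ℂ) + (α : ℂ) + 1)) =
      (((1 - ∑ i, ‖z i‖ * ‖w i‖) ^ (-(n + α + 1)) : ℝ) : ℂ) := by
    rw [Complex.ofReal_cpow (sub_pos.mpr (sum_norm_mul_lt_one hz hw)).le]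
    push_cast
    rfl
  rw [e1] at h
  refine Complex.hasSum_ofReal.mp (h.congr_fun fun m => ?_)
  have e : Real.sqrt (monomialFactor n α m) * Real.sqrt (monomialFactor n α m) =
      monomialFactor n α m := Real.mul_self_sqrt (monomialFactor_pos hα m).le
  simp only [basisMonomial_eq, norm_mul, norm_prod, norm_pow, Complex.norm_real,
    Real.norm_of_nonneg (Real.sqrt_nonneg _)]
  rw [mul_mul_mul_comm, e]
  push_cast
  simp only [mul_pow, Finset.prod_mul_distrib]

/-- Integration against the Bergman kernel is the expansion in the normalised monomials. -/
theorem hasSum_integral_bergmanKernel {n : ℕ} {α : ℝ} (hα : -1 < α) {h : (Fin n → ℂ) → ℂ}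
    (hh : Integrable h (weightedMeasure n α)) {z : Fin n → ℂ} (hz : z ∈ unitBall n) :
    HasSum (fun m => basisMonomial n α m z *
        ∫ w, h w * (starRingEnd ℂ) (basisMonomial n α m w) ∂weightedMeasure n α)
      (∫ w, h w * (1 - ∑ i, z i * (starRingEnd ℂ) (w i)) ^ (-((n : ℂ) + (α : ℂ) + 1))
        ∂weightedMeasure n α) := by
  have hn : (0 : ℝ) ≤ n := n.cast_nonneg
  have hz' : ∑ i, ‖z i‖ ^ 2 < 1 := hz
  have hs := hasSum_integral_of_dominated_convergence (μ := weightedMeasure n α)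
    (F := fun m w => h w * (basisMonomial n α m z * (starRingEnd ℂ) (basisMonomial n α m w)))
    (f := fun w => h w *
      (1 - ∑ i, z i * (starRingEnd ℂ) (w i)) ^ (-((n : ℂ) + (α : ℂ) + 1)))
    (fun m w => ‖h w‖ * (‖basisMonomial n α m z‖ * ‖basisMonomial n α m w‖)) ?_ ?_ ?_ ?_ ?_
  · refine hs.congr_fun fun m => ?_
    rw [← integral_const_mul]
    refine integral_congr_ae (ae_of_all _ fun w => ?_)
    simp only
    ring
  · intro m
    exact hh.aestronglyMeasurable.mul (((Complex.continuous_conj.measurable.comp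
      (measurable_basisMonomial n α m)).const_mul _).aestronglyMeasurable)
  · refine fun m => ae_of_all _ fun w => ?_
    rw [norm_mul, norm_mul, RCLike.norm_conj]
  · filter_upwards [ae_mem_unitBall n α] with w hw
    exact (hasSum_norm_basisMonomial_mul hα hz hw).summable.mul_left _
  · -- for fixed `z` the kernel is bounded on the ball
    have e : (fun w => ∑' m, ‖h w‖ * (‖basisMonomial n α m z‖ * ‖basisMonomial n α m w‖))
        =ᵐ[weightedMeasure n α] fun w => ‖h w‖ * (1 - ∑ i, ‖z i‖ * ‖w i‖) ^ (-(n + α + 1)) := by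
      filter_upwards [ae_mem_unitBall n α] with w hw
      rw [tsum_mul_left, (hasSum_norm_basisMonomial_mul hα hz hw).tsum_eq]
    refine Integrable.congr ?_ e.symm
    refine hh.norm.mul_bdd (c := (1 - (∑ i, ‖z i‖ ^ 2 + 1) / 2) ^ (-(n + α + 1)))
      (Measurable.aestronglyMeasurable (by fun_prop)) ?_
    filter_upwards [ae_mem_unitBall n α] with w hw
    have h1 := sum_norm_mul_lt_one hz hw
    rw [Real.norm_of_nonneg (Real.rpow_nonneg (by linarith) _)]
    refine Real.rpow_le_rpow_of_nonpos (by linarith) ?_ (by linarith)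
    linarith [sum_norm_mul_le (z := z) hw]
  · filter_upwards [ae_mem_unitBall n α] with w hw
    exact (hasSum_basisMonomial_mul_conj hα hz hw).mul_left _

/-! ### The monomial basis of the Bergman space -/

theorem inner_eq_integral {n : ℕ} {α : ℝ} {g : (Fin n → ℂ) → ℂ}
    (hg : MemLp g 2 (weightedMeasure n α)) (f : Lp ℂ 2 (weightedMeasure n α)) :
    inner ℂ (hg.toLp g) f = ∫ z, f z * (starRingEnd ℂ) (g z) ∂weightedMeasure n α := by
  rw [L2.inner_def]
  refine integral_congr_ae ?_
  filter_upwards [hg.coeFn_toLp] with z hz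
  rw [RCLike.inner_apply, hz]

/-- The normalised monomial `e_m` as an element of the Bergman space. -/
def basisVector (n : ℕ) {α : ℝ} (hα : -1 < α) (m : Fin n → ℕ) : bergmanSpace n α :=
  ⟨(memLp_basisMonomial hα m).toLp _, basisMonomial n α m,
    (differentiable_basisMonomial n α m).differentiableOn, MemLp.coeFn_toLp _⟩

theorem coeFn_basisVector {n : ℕ} {α : ℝ} (hα : -1 < α) (m : Fin n → ℕ) :
    (basisVector n hα m : Lp ℂ 2 (weightedMeasure n α)) =ᵐ[weightedMeasure n α]
      basisMonomial n α m :=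
  (memLp_basisMonomial hα m).coeFn_toLp

theorem inner_basisVector {n : ℕ} {α : ℝ} (hα : -1 < α) (m : Fin n → ℕ)
    (f : Lp ℂ 2 (weightedMeasure n α)) :
    inner ℂ (basisVector n hα m : Lp ℂ 2 (weightedMeasure n α)) f =
      ∫ z, f z * (starRingEnd ℂ) (basisMonomial n α m z) ∂weightedMeasure n α :=
  inner_eq_integral (memLp_basisMonomial hα m) f

theorem orthonormal_basisVector (n : ℕ) {α : ℝ} (hα : -1 < α) :
    Orthonormal ℂ (basisVector n hα) := by
  classical
  rw [orthonormal_iff_ite]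
  intro m k
  have e : inner ℂ (basisVector n hα m) (basisVector n hα k) =
      ∫ z, basisMonomial n α k z * (starRingEnd ℂ) (basisMonomial n α m z)
        ∂weightedMeasure n α := by
    rw [Submodule.coe_inner, inner_basisVector]
    refine integral_congr_ae ?_
    filter_upwards [coeFn_basisVector hα k] with z hz
    rw [hz]
  rw [e]
  split_ifs with h
  · subst h
    simp only [Complex.mul_conj, Complex.normSq_eq_norm_sq]
    rw [integral_complex_ofReal, integral_norm_basisMonomial_sq hα, Complex.ofReal_one]
  · have := integral_radial_basisMonomial_ne α (fun _ => 1) h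
    simpa using this

theorem orthogonal_span_basisVector (n : ℕ) {α : ℝ} (hα : -1 < α) :
    (Submodule.span ℂ (range (basisVector n hα)))ᗮ = ⊥ := by
  rw [Submodule.eq_bot_iff]
  intro f hf
  obtain ⟨g, hg, hfg⟩ := f.2
  have hgL : MemLp g 2 (weightedMeasure n α) := (memLp_congr_ae hfg).mp (Lp.memLp f.1)
  have h0 : ∀ m : Fin n → ℕ,
      ∫ z, g z * (starRingEnd ℂ) (basisMonomial n α m z) ∂weightedMeasure n α = 0 := by
    intro m
    have h1 := (Submodule.mem_orthogonal _ _).mp hf _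
      (Submodule.subset_span (mem_range_self m))
    rw [Submodule.coe_inner, inner_basisVector] at h1
    rw [← h1]
    refine integral_congr_ae ?_
    filter_upwards [hfg] with z hz
    rw [hz]
  refine Subtype.ext (Lp.ext ?_)
  filter_upwards [hfg, ae_mem_unitBall n α, Lp.coeFn_zero ℂ 2 (weightedMeasure n α)]
    with z h1 h2 h3
  rw [h1, eq_zero_of_orthogonal_basisMonomial hα hg hgL h0 h2, Submodule.coe_zero, h3, Pi.zero_apply]

/-- The normalised monomials form a Hilbert basis of the Bergman space. -/
def bergmanBasis (n : ℕ) {α : ℝ} (hα : -1 < α) : HilbertBasis (Fin n → ℕ) ℂ (bergmanSpace n α) :=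
  HilbertBasis.mkOfOrthogonalEqBot (orthonormal_basisVector n hα)
    (orthogonal_span_basisVector n hα)

theorem bergmanBasis_apply {n : ℕ} {α : ℝ} (hα : -1 < α) (m : Fin n → ℕ) :
    bergmanBasis n hα m = basisVector n hα m := by
  rw [bergmanBasis, HilbertBasis.coe_mkOfOrthogonalEqBot]

theorem bergmanBasis_repr_apply {n : ℕ} {α : ℝ} (hα : -1 < α) (f : bergmanSpace n α)
    (m : Fin n → ℕ) : (bergmanBasis n hα).repr f m =
      ∫ z, (f : Lp ℂ 2 (weightedMeasure n α)) z *
        (starRingEnd ℂ) (basisMonomial n α m z) ∂weightedMeasure n α := by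
  rw [HilbertBasis.repr_apply_apply, bergmanBasis_apply, Submodule.coe_inner, inner_basisVector]

theorem isCoefficientMap_bergmanBasis (n : ℕ) {α : ℝ} (hα : -1 < α) :
    IsCoefficientMap (bergmanBasis n hα).repr :=
  bergmanBasis_repr_apply hα

/-- The expansion in the monomial basis converges pointwise on the ball, because point evaluations
are continuous on the Bergman space. -/
theorem hasSum_repr_mul_basisMonomial {n : ℕ} {α : ℝ} (hα : -1 < α) {f : bergmanSpace n α}
    {g : (Fin n → ℂ) → ℂ} (hg : DifferentiableOn ℂ g (unitBall n))
    (hfg : (f : Lp ℂ 2 (weightedMeasure n α)) =ᵐ[weightedMeasure n α] g)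
    {z : Fin n → ℂ} (hz : z ∈ unitBall n) :
    HasSum (fun m => basisMonomial n α m z * (bergmanBasis n hα).repr f m) (g z) := by
  have hc : 0 < weightConst n α := by
    have hn : (0 : ℝ) ≤ n := n.cast_nonneg
    have h1 : 0 < Real.Gamma (n + α + 1) := Real.Gamma_pos_of_pos (by linarith)
    have h2 : 0 < Real.Gamma (α + 1) := Real.Gamma_pos_of_pos (by linarith)
    unfold weightConst
    positivity
  obtain ⟨ε, hε, -, C, hC⟩ := exists_local_bound hc hz
  have hs := (bergmanBasis n hα).hasSum_repr f
  have hbd : ∀ s : Finset (Fin n → ℕ),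
      ‖(∑ m ∈ s, basisMonomial n α m z * (bergmanBasis n hα).repr f m) - g z‖ ≤
        C * ‖(∑ m ∈ s, (bergmanBasis n hα).repr f m • bergmanBasis n hα m) - f‖ := by
    intro s
    set c := (bergmanBasis n hα).repr f with hcdef
    have hd : DifferentiableOn ℂ
        (fun w => (∑ m ∈ s, basisMonomial n α m w * c m) - g w) (unitBall n) := by
      refine DifferentiableOn.sub (Differentiable.differentiableOn ?_) hg
      exact Differentiable.fun_sum fun m _ =>
        (differentiable_basisMonomial n α m).mul_const _
    have h1 := hC _ hd z (Metric.mem_ball_self hε)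
    have h2 : (((∑ m ∈ s, c m • bergmanBasis n hα m) - f : bergmanSpace n α) :
        Lp ℂ 2 (weightedMeasure n α)) =ᵐ[weightedMeasure n α]
        fun w => (∑ m ∈ s, basisMonomial n α m w * c m) - g w := by
      have h3 : ∀ s : Finset (Fin n → ℕ), ((∑ m ∈ s, c m • bergmanBasis n hα m :
          bergmanSpace n α) : Lp ℂ 2 (weightedMeasure n α)) =ᵐ[weightedMeasure n α]
          fun w => ∑ m ∈ s, basisMonomial n α m w * c m := by
        intro s
        classical
        induction s using Finset.induction_on with
        | empty =>
          simp only [Finset.sum_empty]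
          exact Lp.coeFn_zero _ _ _
        | insert k s hk ih =>
          rw [Finset.sum_insert hk, Submodule.coe_add, Submodule.coe_smul]
          filter_upwards [ih, Lp.coeFn_add (c k • (bergmanBasis n hα k :
            Lp ℂ 2 (weightedMeasure n α))) ((∑ m ∈ s, c m • bergmanBasis n hα m :
            bergmanSpace n α) : Lp ℂ 2 (weightedMeasure n α)),
            Lp.coeFn_smul (c k) (bergmanBasis n hα k : Lp ℂ 2 (weightedMeasure n α)),
            coeFn_basisVector hα k] with w h1 h2 h3 h4
          rw [← bergmanBasis_apply] at h4
          rw [h2, Pi.add_apply, h1, h3, Pi.smul_apply, h4, Finset.sum_insert hk, smul_eq_mul,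
            mul_comm]
      rw [Submodule.coe_sub]
      filter_upwards [h3 s, hfg, Lp.coeFn_sub ((∑ m ∈ s, c m • bergmanBasis n hα m :
            bergmanSpace n α) : Lp ℂ 2 (weightedMeasure n α)) f.1] with w h1 h2 h3
      rw [h3, Pi.sub_apply, h1, h2]
    rw [← eLpNorm_congr_ae h2, ← Lp.enorm_def, ← ofReal_norm, ← ofReal_norm,
      ← ENNReal.ofReal_coe_nnreal, ← ENNReal.ofReal_mul (by positivity),
      ENNReal.ofReal_le_ofReal_iff (by positivity)] at h1
    exact h1
  have hlim : Tendsto (fun s : Finset (Fin n → ℕ) =>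
      C * ‖(∑ m ∈ s, (bergmanBasis n hα).repr f m • bergmanBasis n hα m) - f‖) atTop (𝓝 0) := by
    have h1 : Tendsto (fun s : Finset (Fin n → ℕ) =>
      (∑ m ∈ s, (bergmanBasis n hα).repr f m • bergmanBasis n hα m)) atTop (𝓝 f) := hs
    have := (tendsto_iff_norm_sub_tendsto_zero.mp h1).const_mul (C : ℝ)
    rwa [mul_zero] at this
  exact tendsto_iff_norm_sub_tendsto_zero.mpr
    (squeeze_zero (fun _ => norm_nonneg _) hbd hlim)

/-! ### Toeplitz operators with radial symbols are diagonal -/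

/-- Bounded symbols are essentially bounded with respect to the weighted measure. -/
theorem memLp_top_weightedMeasure {n : ℕ} (α : ℝ) {a : (Fin n → ℂ) → ℂ}
    (ha : MemLp a ⊤ (volume.restrict (unitBall n))) : MemLp a ⊤ (weightedMeasure n α) := by
  have hac := weightedMeasure_absolutelyContinuous n α
  refine ⟨ha.1.mono_ac hac, ?_⟩
  rw [eLpNorm_exponent_top]
  refine (eLpNormEssSup_mono_measure a hac).trans_lt ?_
  rw [← eLpNorm_exponent_top]
  exact ha.2

/-- The compression to the Bergman space of the multiplication by a bounded symbol. -/
def toeplitz {n : ℕ} {α : ℝ} {a : (Fin n → ℂ) → ℂ} (ha : MemLp a ⊤ (weightedMeasure n α)) :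
    bergmanSpace n α →L[ℂ] bergmanSpace n α :=
  (bergmanSpace n α).orthogonalProjectionOnto ∘L
    (ContinuousLinearMap.mul ℂ ℂ).holderL (weightedMeasure n α) ⊤ 2 2 (ha.toLp a) ∘L
    (bergmanSpace n α).subtypeL

theorem repr_toeplitz {n : ℕ} {α : ℝ} (hα : -1 < α) {a : (Fin n → ℂ) → ℂ}
    (ha : MemLp a ⊤ (weightedMeasure n α)) (f : bergmanSpace n α) (m : Fin n → ℕ) :
    (bergmanBasis n hα).repr (toeplitz ha f) m =
      ∫ z, a z * (f : Lp ℂ 2 (weightedMeasure n α)) z *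
        (starRingEnd ℂ) (basisMonomial n α m z) ∂weightedMeasure n α := by
  rw [HilbertBasis.repr_apply_apply, bergmanBasis_apply, toeplitz]
  simp only [ContinuousLinearMap.comp_apply]
  rw [Submodule.inner_orthogonalProjectionOnto_eq_of_mem_left, inner_basisVector]
  refine integral_congr_ae ?_
  filter_upwards [ContinuousLinearMap.coeFn_holder (r := 2) (ContinuousLinearMap.mul ℂ ℂ)
    (ha.toLp a) (f : Lp ℂ 2 (weightedMeasure n α)), ha.coeFn_toLp] with z h1 h2
  simp only [ContinuousLinearMap.holderL_apply_apply, Submodule.subtypeL_apply]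
  rw [h1, ContinuousLinearMap.mul_apply', h2]

/-- Both sides of the defining formula of a Toeplitz operator have the same expansion in monomials:
the value of a function in the Bergman space by continuity of point evaluations, the integral
against the kernel by the expansion of the kernel. -/
theorem isToeplitzOperator_toeplitz {n : ℕ} {α : ℝ} (hα : -1 < α) {a : (Fin n → ℂ) → ℂ}
    (ha : MemLp a ⊤ (weightedMeasure n α)) : IsToeplitzOperator a (toeplitz ha) := by
  have := isProbabilityMeasure_weightedMeasure n hα
  intro f
  obtain ⟨g, hg, hfg⟩ := (toeplitz ha f).2
  have hint : Integrable (fun w => a w * (f : Lp ℂ 2 (weightedMeasure n α)) w)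
      (weightedMeasure n α) :=
    ((Lp.memLp (f : Lp ℂ 2 (weightedMeasure n α))).mul ha (r := 2)).integrable (by norm_num)
  filter_upwards [hfg, ae_mem_unitBall n α] with z h1 hz
  rw [h1]
  have h2 := hasSum_repr_mul_basisMonomial hα hg hfg hz
  simp only [repr_toeplitz] at h2
  exact h2.unique (hasSum_integral_bergmanKernel hα hint hz)

theorem IsToeplitzOperator.unique {n : ℕ} {α : ℝ} {a : (Fin n → ℂ) → ℂ}
    {T T' : bergmanSpace n α →L[ℂ] bergmanSpace n α} (hT : IsToeplitzOperator a T)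
    (hT' : IsToeplitzOperator a T') : T = T' := by
  refine ContinuousLinearMap.ext fun f => Subtype.ext (Lp.ext ?_)
  filter_upwards [hT f, hT' f] with z h1 h2
  rw [h1, h2]

/-- The eigenvalue at `m` of the Toeplitz operator with symbol `a`: the mean of `a` with respect to
the density `|e_m|²`. -/
def symbolMean {n : ℕ} (α : ℝ) (a : (Fin n → ℂ) → ℂ) (m : Fin n → ℕ) : ℂ :=
  ∫ z, a z * basisMonomial n α m z * (starRingEnd ℂ) (basisMonomial n α m z) ∂weightedMeasure n α

/-- Toeplitz operators with separately radial symbols are diagonal in the monomial basis. -/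
theorem repr_toeplitz_of_isProfile {n : ℕ} {α : ℝ} (hα : -1 < α) {a : (Fin n → ℂ) → ℂ}
    (ha : MemLp a ⊤ (weightedMeasure n α)) {p : (Fin n → ℝ) → ℂ} (hp : IsProfile a p)
    (f : bergmanSpace n α) (m : Fin n → ℕ) :
    (bergmanBasis n hα).repr (toeplitz ha f) m =
      symbolMean α a m * (bergmanBasis n hα).repr f m := by
  have hpa := (weightedMeasure_absolutelyContinuous n α).ae_le hp.2
  have hψ : MemLp (fun z => (starRingEnd ℂ) (a z) * basisMonomial n α m z) 2
      (weightedMeasure n α) := (memLp_basisMonomial hα m).mul ha.star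
  have hin : ∀ g : bergmanSpace n α, inner ℂ (hψ.toLp _) (g : Lp ℂ 2 (weightedMeasure n α)) =
      ∫ z, a z * (g : Lp ℂ 2 (weightedMeasure n α)) z *
        (starRingEnd ℂ) (basisMonomial n α m z) ∂weightedMeasure n α := by
    intro g
    rw [inner_eq_integral]
    refine integral_congr_ae (ae_of_all _ fun z => ?_)
    simp only [map_mul, Complex.conj_conj]
    ring
  have hb : ∀ k, inner ℂ (hψ.toLp _) (bergmanBasis n hα k : Lp ℂ 2 (weightedMeasure n α)) =
      ∫ z, a z * basisMonomial n α k z *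
        (starRingEnd ℂ) (basisMonomial n α m z) ∂weightedMeasure n α := by
    intro k
    rw [hin, bergmanBasis_apply]
    refine integral_congr_ae ?_
    filter_upwards [coeFn_basisVector hα k] with z hz
    rw [hz]
  have h1 := ((bergmanBasis n hα).hasSum_repr f).mapL
    ((innerSL ℂ (hψ.toLp _)) ∘L (bergmanSpace n α).subtypeL)
  simp only [ContinuousLinearMap.comp_apply, Submodule.subtypeL_apply, innerSL_apply_apply,
    Submodule.coe_smul, inner_smul_right, hb] at h1
  rw [hin, ← repr_toeplitz hα ha] at h1
  have h2 : HasSum (fun k => (bergmanBasis n hα).repr f k * ∫ z, a z * basisMonomial n α k z *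
      (starRingEnd ℂ) (basisMonomial n α m z) ∂weightedMeasure n α)
      ((bergmanBasis n hα).repr f m * symbolMean α a m) := by
    refine hasSum_single m fun k hk => ?_
    have h3 := integral_radial_basisMonomial_ne α p hk.symm
    rw [integral_congr_ae (g := fun z => p (fun i => ‖z i‖) * basisMonomial n α k z *
      (starRingEnd ℂ) (basisMonomial n α m z)), h3, mul_zero]
    filter_upwards [hpa] with z hz
    rw [hz]
  rw [h1.unique h2, mul_comm]

/-! ### Polar coordinates -/

theorem integral_comp_norm {n : ℕ} (F : (Fin n → ℝ) → ℂ) :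
    ∫ z : Fin n → ℂ, F (fun i => ‖z i‖) =
      (2 * Real.pi) ^ n * ∫ r in univ.pi fun _ : Fin n => Ioi (0 : ℝ), ((∏ i, r i : ℝ) : ℂ) * F r := by
  rw [← Complex.integral_comp_pi_polarCoord_symm]
  set e := MeasurableEquiv.arrowProdEquivProdArrow ℝ ℝ (Fin n) with he
  have hmp : MeasurePreserving e volume volume :=
    volume_measurePreserving_arrowProdEquivProdArrow ℝ ℝ (Fin n)
  set S : Set (Fin n → ℝ) := univ.pi fun _ => Ioi (0 : ℝ) with hS
  set A : Set (Fin n → ℝ) := univ.pi fun _ => Ioo (-Real.pi) Real.pi with hA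
  have hset : (univ.pi fun _ : Fin n => Complex.polarCoord.target) = e ⁻¹' (S ×ˢ A) := by
    ext p
    simp only [Complex.polarCoord_target, mem_univ_pi, mem_preimage, mem_prod, hS, hA]
    exact forall_and
  have hSm : MeasurableSet S := MeasurableSet.univ_pi fun _ => measurableSet_Ioi
  have hAm : MeasurableSet A := MeasurableSet.univ_pi fun _ => measurableSet_Ioo
  have h1 : ∫ p in (univ.pi fun _ : Fin n => Complex.polarCoord.target),
      (∏ i, (p i).1) • F (fun i => ‖Complex.polarCoord.symm (p i)‖) =
      ∫ p in e ⁻¹' (S ×ˢ A), (fun q : (Fin n → ℝ) × (Fin n → ℝ) =>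
        (((∏ i, q.1 i : ℝ) : ℂ) * F q.1) * 1) (e p) := by
    rw [hset]
    refine setIntegral_congr_fun (e.measurable (hSm.prod hAm)) fun p hp => ?_
    have hpos : ∀ i, 0 < (p i).1 := fun i => (mem_univ_pi.mp (mem_prod.mp hp).1) i
    have e1 : (fun i => ‖Complex.polarCoord.symm (p i)‖) = fun i => (p i).1 := by
      funext i
      rw [Complex.norm_polarCoord_symm, abs_of_pos (hpos i)]
    simp only [e1, mul_one, Complex.real_smul]
    rfl
  have hvol : ∫ _θ in A, (1 : ℂ) = (2 * Real.pi) ^ n := by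
    rw [setIntegral_const, Measure.real, hA, volume_pi_pi]
    simp only [Real.volume_Ioo, Finset.prod_const, Finset.card_univ, Fintype.card_fin,
      ENNReal.toReal_pow, Complex.real_smul, mul_one]
    rw [ENNReal.toReal_ofReal (by linarith [Real.pi_pos])]
    push_cast
    ring
  rw [h1]
  refine (hmp.setIntegral_preimage_emb e.measurableEmbedding
    (fun q : (Fin n → ℝ) × (Fin n → ℝ) => (((∏ i, q.1 i : ℝ) : ℂ) * F q.1) * 1) _).trans ?_
  rw [Measure.volume_eq_prod]
  refine (setIntegral_prod_mul (fun r : Fin n → ℝ => ((∏ i, r i : ℝ) : ℂ) * F r)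
    (fun _ : Fin n → ℝ => (1 : ℂ)) S A).trans ?_
  rw [hvol, mul_comm]

theorem radialBase_ae_eq (n : ℕ) :
    radialBase n =ᵐ[volume]
      ((univ.pi fun _ : Fin n => Ioi (0 : ℝ)) ∩ {r | ∑ i, r i ^ 2 < 1} : Set (Fin n → ℝ)) := by
  have h : (univ.pi fun _ : Fin n => Ici (0 : ℝ)) =ᵐ[volume] univ.pi fun _ : Fin n => Ioi (0 : ℝ) :=
    Measure.ae_eq_set_pi fun _ _ => Ioi_ae_eq_Ici.symm
  have e : radialBase n = (univ.pi fun _ : Fin n => Ici (0 : ℝ)) ∩ {r | ∑ i, r i ^ 2 < 1} := by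
    ext r
    simp [radialBase, Pi.le_def]
  rw [e]
  exact h.inter (ae_eq_refl _)

/-- In polar coordinates the eigenvalues of the Toeplitz operator become the spectral function. -/
theorem symbolMean_eq_spectralFunction {n : ℕ} {α : ℝ} (hα : -1 < α) {a : (Fin n → ℂ) → ℂ}
    {p : (Fin n → ℝ) → ℂ} (hp : IsProfile a p) (m : Fin n → ℕ) :
    symbolMean α a m = spectralFunction α p m := by
  have hn : (0 : ℝ) ≤ n := n.cast_nonneg
  have hg1 : Real.Gamma (n + α + 1) ≠ 0 := (Real.Gamma_pos_of_pos (by linarith)).ne'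
  have hg2 : Real.Gamma (α + 1) ≠ 0 := (Real.Gamma_pos_of_pos (by linarith)).ne'
  have hU := (isOpen_unitBall n).measurableSet
  set B : Set (Fin n → ℝ) := {r | ∑ i, r i ^ 2 < 1} with hB
  have hBm : MeasurableSet B := (isOpen_lt (by fun_prop) continuous_const).measurableSet
  set D : ℝ := Real.Gamma (n + α + 1) / (Real.pi ^ n * Real.Gamma (α + 1)) *
    monomialFactor n α m with hD
  set G : (Fin n → ℝ) → ℂ := fun r =>
    p r * (((∏ i, r i ^ (2 * m i)) * (1 - ∑ i, r i ^ 2) ^ α : ℝ) : ℂ) with hG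
  have h1 : symbolMean α a m = (D : ℂ) * ∫ z : Fin n → ℂ, B.indicator G (fun i => ‖z i‖) := by
    rw [symbolMean, integral_weightedMeasure hα, ← integral_const_mul, ← integral_indicator hU]
    refine integral_congr_ae ?_
    have hp2 := (ae_restrict_iff' hU).mp hp.2
    filter_upwards [hp2] with z hz
    have hmem : z ∈ unitBall n ↔ (fun i => ‖z i‖) ∈ B := Iff.rfl
    by_cases hzU : z ∈ unitBall n
    · rw [indicator_of_mem hzU, indicator_of_mem (hmem.mp hzU), hz hzU, mul_assoc (p _),
        basisMonomial_mul_conj hα]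
      simp only [ballWeight, hG, hD]
      push_cast
      ring
    · rw [indicator_of_notMem hzU, indicator_of_notMem (fun h => hzU (hmem.mpr h)), mul_zero]
  have h2 : (fun r : Fin n → ℝ => ((∏ i, r i : ℝ) : ℂ) * B.indicator G r) =
      B.indicator fun r => ((∏ i, r i : ℝ) : ℂ) * G r := by
    funext r
    by_cases hr : r ∈ B
    · simp [hr]
    · simp [hr]
  rw [h1, integral_comp_norm, h2, setIntegral_indicator hBm,
    ← setIntegral_congr_set (radialBase_ae_eq n), spectralFunction, ← mul_assoc]
  congr 1
  · have hf : (∏ i, ((m i).factorial : ℂ)) ≠ 0 :=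
      Finset.prod_ne_zero_iff.mpr fun i _ => by exact_mod_cast (m i).factorial_ne_zero
    have hpi : (Real.pi : ℂ) ≠ 0 := by exact_mod_cast Real.pi_ne_zero
    have hg1' : (Real.Gamma (n + α + 1) : ℂ) ≠ 0 := by exact_mod_cast hg1
    have hg2' : (Real.Gamma (α + 1) : ℂ) ≠ 0 := by exact_mod_cast hg2
    simp only [hD, monomialFactor]
    push_cast
    field_simp
    ring
  · refine integral_congr_ae (ae_of_all _ fun r => ?_)
    simp only [hG]
    push_cast
    ring

/-! ### Permutations of the coordinates -/

theorem basisMonomial_permIndex {n : ℕ} (α : ℝ) (σ : Equiv.Perm (Fin n)) (m : Fin n → ℕ)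
    (z : Fin n → ℂ) :
    basisMonomial n α (permIndex σ m) (fun i => z (σ i)) = basisMonomial n α m z := by
  have h1 : ∑ i, permIndex σ m i = ∑ i, m i := Equiv.sum_comp σ m
  have h2 : ∏ i, (permIndex σ m i).factorial = ∏ i, (m i).factorial :=
    Equiv.prod_comp σ fun i => (m i).factorial
  have h3 : ∏ i, z (σ i) ^ permIndex σ m i = ∏ i, z i ^ m i :=
    Equiv.prod_comp σ fun i => z i ^ m i
  rw [basisMonomial_eq, basisMonomial_eq, h3, monomialFactor, monomialFactor, h1, h2]

/-- The eigenvalues inherit the permutation symmetries of the symbol. -/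
theorem symbolMean_permIndex {n : ℕ} (α : ℝ) {a : (Fin n → ℂ) → ℂ} {σ : Equiv.Perm (Fin n)}
    (h : ∀ᵐ z ∂volume.restrict (unitBall n), a (fun i => z (σ i)) = a z) (m : Fin n → ℕ) :
    symbolMean α a (permIndex σ m) = symbolMean α a m := by
  have hmp := measurePreserving_perm_weightedMeasure α σ
  have hemb : MeasurableEmbedding (fun z : Fin n → ℂ => fun i => z (σ i)) := by
    refine (Homeomorph.toMeasurableEquiv
      (⟨⟨fun z i => z (σ i), fun z i => z (σ.symm i), fun z => ?_, fun z => ?_⟩,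
        by fun_prop, by fun_prop⟩ : (Fin n → ℂ) ≃ₜ (Fin n → ℂ))).measurableEmbedding
    · funext i
      simp
    · funext i
      simp
  rw [symbolMean, ← hmp.integral_comp hemb]
  refine integral_congr_ae ?_
  filter_upwards [(weightedMeasure_absolutelyContinuous n α).ae_le h] with z hz
  rw [hz, basisMonomial_permIndex]

/-! ### The block decomposition -/

theorem permIndex_mul {n : ℕ} (σ τ : Equiv.Perm (Fin n)) (m : Fin n → ℕ) :
    permIndex (σ * τ) m = permIndex τ (permIndex σ m) := rfl

/-- Non-increasing multi-indices in the same orbit coincide. -/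
theorem eq_of_antitone_of_permIndex {n : ℕ} {ι κ : Fin n → ℕ} (hι : Antitone ι) (hκ : Antitone κ)
    {σ τ : Equiv.Perm (Fin n)} (h : permIndex σ ι = permIndex τ κ) : ι = κ := by
  have e : κ = ι ∘ (σ * τ⁻¹ : Equiv.Perm (Fin n)) := by
    funext i
    have := congrFun h (τ⁻¹ i)
    simpa [permIndex] using this.symm
  have h1 : Antitone (ι ∘ (1 : Equiv.Perm (Fin n))) := hι
  have h2 : Antitone (ι ∘ (σ * τ⁻¹ : Equiv.Perm (Fin n))) := e ▸ hκ
  have h3 := Tuple.unique_antitone h1 h2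
  rw [e, ← h3]
  rfl

theorem exists_antitone_permIndex {n : ℕ} (m : Fin n → ℕ) :
    ∃ ι : Fin n → ℕ, Antitone ι ∧ ∃ σ : Equiv.Perm (Fin n), m = permIndex σ ι := by
  set s : Equiv.Perm (Fin n) := Tuple.sort (fun i => OrderDual.toDual (m i)) with hs
  refine ⟨fun i => m (s i), ?_, s⁻¹, ?_⟩
  · have := Tuple.monotone_sort (fun i => OrderDual.toDual (m i))
    exact fun i j hij => this hij
  · funext i
    simp [permIndex]

theorem evenOrbit_subset_permOrbit {n : ℕ} (ι : Fin n → ℕ) : evenOrbit ι ⊆ permOrbit ι :=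
  fun _ ⟨σ, _, h⟩ => ⟨σ, h⟩

theorem oddOrbit_subset_permOrbit {n : ℕ} (ι : Fin n → ℕ) : oddOrbit ι ⊆ permOrbit ι :=
  fun _ ⟨σ, _, h⟩ => ⟨σ, h⟩

theorem disjoint_permOrbit {n : ℕ} {ι κ : Fin n → ℕ} (hι : Antitone ι) (hκ : Antitone κ)
    (h : ι ≠ κ) : Disjoint (permOrbit ι) (permOrbit κ) :=
  Set.disjoint_left.mpr fun _ ⟨_, hσ⟩ ⟨_, hτ⟩ =>
    h (eq_of_antitone_of_permIndex hι hκ (hσ.symm.trans hτ))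

theorem disjoint_evenOrbit_oddOrbit {n : ℕ} {ι : Fin n → ℕ} (hι : StrictAnti ι) :
    Disjoint (evenOrbit ι) (oddOrbit ι) := by
  refine Set.disjoint_left.mpr fun m ⟨σ, hσe, hσ⟩ ⟨τ, hτo, hτ⟩ => hτo ?_
  have : τ = σ := Equiv.ext fun i => hι.injective (congrFun (hτ.symm.trans hσ) i)
  rwa [this]

theorem ne_of_mem_repeated_of_mem_strict {n : ℕ} {ι κ : Fin n → ℕ} (hι : ι ∈ repeatedIndices n)
    (hκ : κ ∈ strictIndices n) : ι ≠ κ := by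
  obtain ⟨-, i, j, hij, h⟩ := hι
  have hκ' : StrictAnti κ := hκ
  rintro rfl
  exact hij (hκ'.injective h)

theorem disjoint_blockIndices {n : ℕ}
    {j k : repeatedIndices n ⊕ (strictIndices n ⊕ strictIndices n)} (h : j ≠ k) :
    Disjoint (blockIndices n j) (blockIndices n k) := by
  have hA : ∀ ι : strictIndices n, Antitone ι.1 := fun ι => StrictAnti.antitone ι.2
  have key : ∀ (ι : repeatedIndices n) (κ : strictIndices n),
      Disjoint (permOrbit ι.1) (permOrbit κ.1) := fun ι κ =>
    disjoint_permOrbit ι.2.1 (hA κ) (ne_of_mem_repeated_of_mem_strict ι.2 κ.2)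
  have key2 : ∀ ι κ : strictIndices n, ι ≠ κ → Disjoint (permOrbit ι.1) (permOrbit κ.1) :=
    fun ι κ hne => disjoint_permOrbit (hA ι) (hA κ) fun e => hne (Subtype.ext e)
  have key3 : ∀ ι κ : strictIndices n, Disjoint (evenOrbit ι.1) (oddOrbit κ.1) := by
    intro ι κ
    by_cases e : ι = κ
    · subst e
      exact disjoint_evenOrbit_oddOrbit ι.2
    · exact (key2 ι κ e).mono (evenOrbit_subset_permOrbit _) (oddOrbit_subset_permOrbit _)
  rcases j with ι | ι | ι <;> rcases k with κ | κ | κ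
  · exact disjoint_permOrbit ι.2.1 κ.2.1 fun e => h (congrArg _ (Subtype.ext e))
  · exact (key ι κ).mono_right (evenOrbit_subset_permOrbit _)
  · exact (key ι κ).mono_right (oddOrbit_subset_permOrbit _)
  · exact ((key κ ι).mono_right (evenOrbit_subset_permOrbit _)).symm
  · exact (key2 ι κ fun e => h (by rw [e])).mono (evenOrbit_subset_permOrbit _)
      (evenOrbit_subset_permOrbit _)
  · exact key3 ι κ
  · exact ((key κ ι).mono_right (oddOrbit_subset_permOrbit _)).symm
  · exact (key3 κ ι).symm
  · exact (key2 ι κ fun e => h (by rw [e])).mono (oddOrbit_subset_permOrbit _)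
      (oddOrbit_subset_permOrbit _)

theorem exists_mem_blockIndices {n : ℕ} (m : Fin n → ℕ) : ∃ j, m ∈ blockIndices n j := by
  obtain ⟨ι, hι, σ, hσ⟩ := exists_antitone_permIndex m
  by_cases hinj : Function.Injective ι
  · by_cases hs : σ ∈ alternatingGroup (Fin n)
    · exact ⟨.inr (.inl ⟨ι, hι.strictAnti_of_injective hinj⟩), σ, hs, hσ⟩
    · exact ⟨.inr (.inr ⟨ι, hι.strictAnti_of_injective hinj⟩), σ, hs, hσ⟩
  · rw [Function.Injective] at hinj
    push Not at hinj
    obtain ⟨i, j, hij, hne⟩ := hinj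
    exact ⟨.inl ⟨ι, hι, i, j, hne, hij⟩, σ, hσ⟩

theorem isClosed_ellTwoOn {n : ℕ} (S : Set (Fin n → ℕ)) :
    IsClosed (ellTwoOn S : Set (EllTwo n)) := by
  have e : (ellTwoOn S : Set (EllTwo n)) =
      ⋂ m : (Sᶜ : Set (Fin n → ℕ)), {x | lp.evalCLM ℂ (fun _ : Fin n → ℕ => ℂ) 2 m.1 x = 0} := by
    ext x
    simp only [mem_iInter, Subtype.forall]
    rfl
  rw [e]
  exact isClosed_iInter fun m => isClosed_eq (lp.evalCLM ℂ _ 2 m.1).continuous continuous_const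

theorem isHilbertSum_ellTwoOn_blockIndices (n : ℕ) :
    IsHilbertSum ℂ (fun j => ellTwoOn (blockIndices n j))
      (fun j => (ellTwoOn (blockIndices n j)).subtypeₗᵢ) := by
  classical
  have hcomp : ∀ j, CompleteSpace (ellTwoOn (blockIndices n j)) := fun j =>
    (isClosed_ellTwoOn _).completeSpace_coe
  refine IsHilbertSum.mkInternal _ ?_ ?_
  · intro j k hjk x y
    change inner ℂ (x : EllTwo n) (y : EllTwo n) = 0
    rw [lp.inner_eq_tsum]
    refine (tsum_congr fun m => ?_).trans tsum_zero
    by_cases hm : m ∈ blockIndices n j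
    · rw [y.2 m (Set.disjoint_left.mp (disjoint_blockIndices hjk) hm), inner_zero_right]
    · rw [x.2 m hm, inner_zero_left]
  · rintro x -
    refine mem_closure_of_tendsto (lp.hasSum_single (by norm_num) x)
      (Eventually.of_forall fun s => ?_)
    refine Submodule.sum_mem _ fun m _ => ?_
    obtain ⟨j, hj⟩ := exists_mem_blockIndices m
    refine Submodule.mem_iSup_of_mem j fun k hk => ?_
    have : k ≠ m := fun e => hk (e ▸ hj)
    simp [lp.single_apply, this]

/-! ### Commutativity and the spectral decomposition -/

/-- Bounded operators which are diagonal in a Hilbert basis commute. -/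
theorem commute_of_diagonal {ι E : Type*} [NormedAddCommGroup E] [InnerProductSpace ℂ E]
    (b : HilbertBasis ι ℂ E) {S T : E →L[ℂ] E} {c d : ι → ℂ}
    (hS : ∀ f m, b.repr (S f) m = c m * b.repr f m)
    (hT : ∀ f m, b.repr (T f) m = d m * b.repr f m) : S * T = T * S := by
  refine ContinuousLinearMap.ext fun f => b.repr.injective (lp.ext (funext fun m => ?_))
  rw [mul_apply_eq_comp, mul_apply_eq_comp, hS, hT, hT, hS]
  ring

/-- The adjoint of a diagonal operator is diagonal. -/
theorem repr_star_of_diagonal {ι E : Type*} [NormedAddCommGroup E] [InnerProductSpace ℂ E]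
    [CompleteSpace E] (b : HilbertBasis ι ℂ E) {T : E →L[ℂ] E} {c : ι → ℂ}
    (hT : ∀ f m, b.repr (T f) m = c m * b.repr f m) (f : E) (m : ι) :
    b.repr (star T f) m = (starRingEnd ℂ) (c m) * b.repr f m := by
  classical
  have h : T (b m) = c m • b m := by
    refine b.repr.injective (lp.ext (funext fun k => ?_))
    rw [hT, map_smul, lp.coeFn_smul, Pi.smul_apply, smul_eq_mul, b.repr_self]
    by_cases hk : k = m
    · rw [hk]
    · simp [lp.single_apply, hk]
  rw [b.repr_apply_apply, ContinuousLinearMap.star_eq_adjoint,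
    ContinuousLinearMap.adjoint_inner_right, h, inner_smul_left, b.repr_apply_apply]

/-- The C*-algebra generated by operators which are diagonal in a common Hilbert basis is
commutative. -/
theorem commute_of_mem_generatedCStarAlgebra {ι E : Type*} [NormedAddCommGroup E]
    [InnerProductSpace ℂ E] [CompleteSpace E] (b : HilbertBasis ι ℂ E) {S : Set (E →L[ℂ] E)}
    (hS : ∀ T ∈ S, ∃ c : ι → ℂ, ∀ f m, b.repr (T f) m = c m * b.repr f m)
    {A B : E →L[ℂ] E} (hA : A ∈ generatedCStarAlgebra S) (hB : B ∈ generatedCStarAlgebra S) :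
    A * B = B * A := by
  have h1 : StarAlgebra.adjoin ℂ S ≤ StarSubalgebra.centralizer ℂ S := by
    rw [StarAlgebra.adjoin_le_iff]
    intro T hT
    obtain ⟨c, hc⟩ := hS T hT
    refine (StarSubalgebra.mem_centralizer_iff ℂ).mpr fun T' hT' => ?_
    obtain ⟨c', hc'⟩ := hS T' hT'
    exact ⟨commute_of_diagonal b hc' hc, commute_of_diagonal b (repr_star_of_diagonal b hc') hc⟩
  have h2 : generatedCStarAlgebra S ≤ StarSubalgebra.centralizer ℂ S :=
    StarSubalgebra.topologicalClosure_minimal h1 (Set.isClosed_centralizer _)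
  -- `A` lies in the commutant of `S` and `B` in the bicommutant
  have h3 := StarSubalgebra.topologicalClosure_adjoin_le_centralizer_centralizer ℂ S hB
  exact ((StarSubalgebra.mem_centralizer_iff ℂ).mp h3 A (h2 hA)).1

/-- Every Toeplitz operator with a separately radial symbol is diagonal in the monomial basis, with
the values of the spectral function as eigenvalues. -/
theorem IsToeplitzOperator.repr_apply {n : ℕ} {α : ℝ} (hα : -1 < α) {a : (Fin n → ℂ) → ℂ}
    (ha : MemLp a ⊤ (volume.restrict (unitBall n))) {p : (Fin n → ℝ) → ℂ} (hp : IsProfile a p)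
    {T : bergmanSpace n α →L[ℂ] bergmanSpace n α} (hT : IsToeplitzOperator a T)
    (f : bergmanSpace n α) (m : Fin n → ℕ) :
    (bergmanBasis n hα).repr (T f) m =
      spectralFunction α p m * (bergmanBasis n hα).repr f m := by
  have ha' := memLp_top_weightedMeasure α ha
  rw [hT.unique (isToeplitzOperator_toeplitz hα ha'), repr_toeplitz_of_isProfile hα ha' hp,
    symbolMean_eq_spectralFunction hα hp]

theorem spectralFunction_permIndex {n : ℕ} {α : ℝ} (hα : -1 < α) {a : (Fin n → ℂ) → ℂ}
    (ha : IsAlternatingSeparatelyRadial a) {p : (Fin n → ℝ) → ℂ} (hp : IsProfile a p)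
    {σ : Equiv.Perm (Fin n)} (hσ : σ ∈ alternatingGroup (Fin n)) (m : Fin n → ℕ) :
    spectralFunction α p (permIndex σ m) = spectralFunction α p m := by
  rw [← symbolMean_eq_spectralFunction hα hp, ← symbolMean_eq_spectralFunction hα hp,
    symbolMean_permIndex α (ha.2.2 σ hσ)]

/-- The spectral function is constant on an orbit of a multi-index with a repeated entry: an odd
permutation can be made even by composing with the transposition of two equal entries. -/
theorem spectralFunction_permIndex_of_repeated {n : ℕ} {α : ℝ} (hα : -1 < α)
    {a : (Fin n → ℂ) → ℂ} (ha : IsAlternatingSeparatelyRadial a) {p : (Fin n → ℝ) → ℂ}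
    (hp : IsProfile a p) (σ : Equiv.Perm (Fin n)) {ι : Fin n → ℕ} (hι : ι ∈ repeatedIndices n) :
    spectralFunction α p (permIndex σ ι) = spectralFunction α p ι := by
  obtain ⟨-, i, j, hij, h⟩ := hι
  by_cases hσ : σ ∈ alternatingGroup (Fin n)
  · exact spectralFunction_permIndex hα ha hp hσ ι
  have hswap : permIndex (Equiv.swap i j) ι = ι := by
    funext k
    rw [permIndex, Equiv.swap_apply_def]
    split_ifs with h1 h2
    · rw [h1, h]
    · rw [h2, h]
    · rfl
  have hσ' : Equiv.swap i j * σ ∈ alternatingGroup (Fin n) := by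
    rw [Equiv.Perm.mem_alternatingGroup] at hσ ⊢
    rw [Equiv.Perm.sign_mul, Equiv.Perm.sign_swap hij,
      (Int.units_eq_one_or (Equiv.Perm.sign σ)).resolve_left hσ]
    rfl
  have h1 := spectralFunction_permIndex hα ha hp hσ' ι
  rwa [permIndex_mul, hswap] at h1

/-- Any two odd permutations differ by an even one. -/
theorem spectralFunction_permIndex_of_odd {n : ℕ} {α : ℝ} (hα : -1 < α)
    {a : (Fin n → ℂ) → ℂ} (ha : IsAlternatingSeparatelyRadial a) {p : (Fin n → ℝ) → ℂ}
    (hp : IsProfile a p) {σ τ : Equiv.Perm (Fin n)} (hσ : σ ∉ alternatingGroup (Fin n))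
    (hτ : τ ∉ alternatingGroup (Fin n)) (ι : Fin n → ℕ) :
    spectralFunction α p (permIndex τ ι) = spectralFunction α p (permIndex σ ι) := by
  have h : σ⁻¹ * τ ∈ alternatingGroup (Fin n) := by
    rw [Equiv.Perm.mem_alternatingGroup] at hσ hτ ⊢
    rw [Equiv.Perm.sign_mul, Equiv.Perm.sign_inv,
      (Int.units_eq_one_or (Equiv.Perm.sign σ)).resolve_left hσ,
      (Int.units_eq_one_or (Equiv.Perm.sign τ)).resolve_left hτ]
    rfl
  have h1 := spectralFunction_permIndex hα ha hp h (permIndex σ ι)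
  rwa [← permIndex_mul, mul_inv_cancel_left] at h1

/-- A diagonal operator whose eigenvalues are constant on `S` is a scalar on `ℓ²(S)`. -/
theorem eq_smul_of_mem_ellTwoOn {n : ℕ} {S : Set (Fin n → ℕ)} {x y : EllTwo n}
    (hx : x ∈ ellTwoOn S) {c : ℂ} {d : (Fin n → ℕ) → ℂ} (hy : ∀ m, y m = d m * x m)
    (hd : ∀ m ∈ S, d m = c) : y = c • x := by
  refine lp.ext (funext fun m => ?_)
  rw [lp.coeFn_smul, Pi.smul_apply, smul_eq_mul, hy]
  by_cases hm : m ∈ S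
  · rw [hd m hm]
  · rw [hx m hm, mul_zero, mul_zero]

end AltToeplitz

end

theorem mainTheorem6 (n : ℕ) (hn : 1 ≤ n) (α : ℝ) (hα : -1 < α) :
    -- every alternating separately radial symbol has a well-defined bounded Toeplitz operator
    (∀ a : (Fin n → ℂ) → ℂ, AltToeplitz.IsAlternatingSeparatelyRadial a →
      ∃! T : AltToeplitz.bergmanSpace n α →L[ℂ] AltToeplitz.bergmanSpace n α,
        AltToeplitz.IsToeplitzOperator a T) ∧
    -- the C*-algebra generated by these operators is commutative
    (∀ A ∈ AltToeplitz.alternatingToeplitzAlgebra n α,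
      ∀ B ∈ AltToeplitz.alternatingToeplitzAlgebra n α, A * B = B * A) ∧
    -- the Hilbert sum decomposition of the sequence space
    IsHilbertSum ℂ (fun j => AltToeplitz.ellTwoOn (AltToeplitz.blockIndices n j))
      (fun j => (AltToeplitz.ellTwoOn (AltToeplitz.blockIndices n j)).subtypeₗᵢ) ∧
    -- the unitary `R` acts as scalars on the blocks after conjugation
    ∃ R : AltToeplitz.bergmanSpace n α ≃ₗᵢ[ℂ] AltToeplitz.EllTwo n,
      AltToeplitz.IsCoefficientMap R ∧
      ∀ a : (Fin n → ℂ) → ℂ, AltToeplitz.IsAlternatingSeparatelyRadial a →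
      ∀ p : (Fin n → ℝ) → ℂ, AltToeplitz.IsProfile a p →
      ∀ T : AltToeplitz.bergmanSpace n α →L[ℂ] AltToeplitz.bergmanSpace n α,
        AltToeplitz.IsToeplitzOperator a T →
        (∀ ι ∈ AltToeplitz.repeatedIndices n,
          ∀ x ∈ AltToeplitz.ellTwoOn (AltToeplitz.permOrbit ι),
            R (T (R.symm x)) = AltToeplitz.spectralFunction α p ι • x) ∧
        (∀ ι ∈ AltToeplitz.strictIndices n,
          (∀ x ∈ AltToeplitz.ellTwoOn (AltToeplitz.evenOrbit ι),
            R (T (R.symm x)) = AltToeplitz.spectralFunction α p ι • x) ∧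
          (∀ σ : Equiv.Perm (Fin n), σ ∉ alternatingGroup (Fin n) →
            ∀ x ∈ AltToeplitz.ellTwoOn (AltToeplitz.oddOrbit ι),
              R (T (R.symm x)) =
                AltToeplitz.spectralFunction α p (AltToeplitz.permIndex σ ι) • x)) := by
  have hR : ∀ a : (Fin n → ℂ) → ℂ, AltToeplitz.IsAlternatingSeparatelyRadial a →
      ∀ p : (Fin n → ℝ) → ℂ, AltToeplitz.IsProfile a p →
      ∀ T : AltToeplitz.bergmanSpace n α →L[ℂ] AltToeplitz.bergmanSpace n α,
        AltToeplitz.IsToeplitzOperator a T → ∀ (x : AltToeplitz.EllTwo n) (m : Fin n → ℕ),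
        (AltToeplitz.bergmanBasis n hα).repr (T ((AltToeplitz.bergmanBasis n hα).repr.symm x)) m =
          AltToeplitz.spectralFunction α p m * x m := by
    intro a ha p hp T hT x m
    rw [hT.repr_apply hα ha.1 hp, LinearIsometryEquiv.apply_symm_apply]
  refine ⟨fun a ha => ?_, fun A hA B hB => ?_,
    AltToeplitz.isHilbertSum_ellTwoOn_blockIndices n,
    (AltToeplitz.bergmanBasis n hα).repr, AltToeplitz.isCoefficientMap_bergmanBasis n hα,
    fun a ha p hp T hT => ⟨fun ι hι x hx => ?_, fun ι hι => ⟨fun x hx => ?_,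
      fun σ hσ x hx => ?_⟩⟩⟩
  · have ha' := AltToeplitz.memLp_top_weightedMeasure α ha.1
    exact ⟨AltToeplitz.toeplitz ha', AltToeplitz.isToeplitzOperator_toeplitz hα ha',
      fun T hT => hT.unique (AltToeplitz.isToeplitzOperator_toeplitz hα ha')⟩
  · refine AltToeplitz.commute_of_mem_generatedCStarAlgebra (AltToeplitz.bergmanBasis n hα) ?_ hA hB
    rintro T ⟨a, ha, hT⟩
    obtain ⟨p, hp⟩ := ha.2.1
    exact ⟨AltToeplitz.spectralFunction α p, hT.repr_apply hα ha.1 hp⟩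
  · refine AltToeplitz.eq_smul_of_mem_ellTwoOn hx (hR a ha p hp T hT x) ?_
    rintro m ⟨τ, rfl⟩
    exact AltToeplitz.spectralFunction_permIndex_of_repeated hα ha hp τ hι
  · refine AltToeplitz.eq_smul_of_mem_ellTwoOn hx (hR a ha p hp T hT x) ?_
    rintro m ⟨τ, hτ, rfl⟩
    exact AltToeplitz.spectralFunction_permIndex hα ha hp hτ ι
  · refine AltToeplitz.eq_smul_of_mem_ellTwoOn hx (hR a ha p hp T hT x) ?_
    rintro m ⟨τ, hτ, rfl⟩
    exact AltToeplitz.spectralFunction_permIndex_of_odd hα ha hp hσ hτ ι
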